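/- Let $a<b$ be real and let $\alpha,\beta,\gamma\in\mathbb{C}$ have positive real parts, with $\operatorname{Re}\gamma<\operatorname{Re}\alpha$. For $\operatorname{Re}\theta>0$ put $m(\theta)=\lfloor\operatorname{Re}\theta\rfloor+1$. Let $\varphi\in C^{m(\alpha)}[a,b]$ be real-valued with $\varphi'>0$ on $[a,b]$, and let $R>(\varphi(b)-\varphi(a))^{\operatorname{Re}\beta}$. For a power series $\mathcal{K}(z)=\sum_n c_nz^n$ convergent on $|z|<R$ and $\operatorname{Re}\theta>0$ define $${}^{\mathcal{K}}_{\ a}I^{\theta,\beta}_{\varphi(x)}u(x)=\int_a^x\varphi'(t)\,[\varphi(x)-\varphi(t)]^{\theta-1}\,\mathcal{K}\big([\varphi(x)-\varphi(t)]^{\beta}\big)\,u(t)\,dt .$$ Let $\mathcal{A}(z)=\sum_n a_n(\theta,\beta)z^n$ be a kernel whose coefficients may depend on $\theta,\beta$ and whose series converges on $|z|<R$ for $\theta\in\{\alpha,\gamma,\alpha-\gamma\}$. For $\theta\in\{\alpha,\alpha-\gamma\}$ let $a_0(\theta,\beta)\neq0$, let $\overline a_n(\theta,\beta)$ be the numbers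 determined by the identity of formal power series $$\Big(\sum_n a_n(\theta,\beta)\Gamma(\beta n+\theta)x^n\Big)\Big(\sum_n\overline a_n(\theta,\beta)\Gamma(\beta n-\theta+m(\theta))x^n\Big)=1,$$ and assume that $\overline{\mathcal{A}}(z)=\sum_n\overline a_n(\theta,\beta)z^n$ converges on $|z|<R$. The fractional derivative of order $(\theta,\beta)$ is $${}^{\mathcal{A}}_{\ a}D^{\theta,\beta}_{\varphi(x)}u=\Big(\tfrac{1}{\varphi'(x)}\tfrac{d}{dx}\Big)^{m(\theta)}\;{}^{\overline{\mathcal{A}}}_{\ a}I^{m(\theta)-\theta,\beta}_{\varphi(x)}u ,$$ and it is said to be defined for $u\in L^1[a,b]$ if the $m(\theta)$ successive derivatives exist at every point of $(a,b]$ (one-sided at $b$). Then the following are equivalent. 1. The composition relation $${}^{\mathcal{A}}_{\ a}D^{\alpha,\beta}_{\varphi(x)}\circ{}^{\mathcal{A}}_{\ a}I^{\gamma,\beta}_{\varphi(x)}u(x)={}^{\mathcal{A}}_{\ a}D^{\alpha-\gamma,\beta}_{\varphi(x)}u(x)\qquad(a<x\le b)$$ holds for every $u\in L^1[a,b]$ for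 which both sides are defined. 2. For every $u\in C^{m(\alpha)}[a,b]$ both sides of this relation are defined and the relation holds. 3. For every integer $k\ge0$, $$\overline a_k(\alpha-\gamma,\beta)\,\Gamma\big(\beta k-\alpha+\gamma+m(\alpha-\gamma)\big)=\sum_{n+p=k}\overline a_n(\alpha,\beta)\,a_p(\gamma,\beta)\,\Gamma\big(\beta n-\alpha+m(\alpha)\big)\,\Gamma(\beta p+\gamma).$$ -/

import Mathlib

noncomputable section

namespace AnalyticKernel

/-- The power series with coefficients `c` converges on the open complex disc `D(0, R)`, that is,
`c` is the coefficient sequence of an analytic function on that disc. -/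
def ConvergesOnDisc (c : ℕ → ℂ) (R : ℝ) : Prop :=
  ∀ z : ℂ, ‖z‖ < R → Summable fun n : ℕ => c n * z ^ n

/-- The analytic function `𝒜(z) = ∑ cₙ zⁿ`. -/
def kernelFun (c : ℕ → ℂ) (z : ℂ) : ℂ := ∑' n : ℕ, c n * z ^ n

/-- The transformed series `𝒜_Γ(x) = ∑ cₙ Γ(β n + θ) xⁿ`, for a kernel that is used with the
parameters `(θ, β)`. It is a formal power series: it may diverge even if `∑ cₙ xⁿ` converges. -/
def gammaSeries (c : ℕ → ℂ) (θ β : ℂ) : PowerSeries ℂ :=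
  PowerSeries.mk fun n : ℕ => c n * Complex.Gamma (β * n + θ)

/-- The generalised fractional integral of order `(θ, β)` of `u` with respect to `φ` on `[a, b]`,
whose kernel is the analytic function with coefficients `c`:
`∫_a^x φ'(t) (φ(x) - φ(t))^(θ-1) 𝒜((φ(x) - φ(t))^β) u(t) dt`. -/
def fracIntegral (a b : ℝ) (φ : ℝ → ℝ) (c : ℕ → ℂ) (θ β : ℂ) (u : ℝ → ℂ) (x : ℝ) : ℂ :=
  ∫ t in a..x, ((derivWithin φ (Set.Icc a b) t : ℝ) : ℂ) * ((φ x - φ t : ℝ) : ℂ) ^ (θ - 1) *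
    kernelFun c (((φ x - φ t : ℝ) : ℂ) ^ β) * u t

/-- The operator `(1/φ'(x)) d/dx` on functions on `[a, b]` (one-sided at the end points). -/
def phiDeriv (a b : ℝ) (φ : ℝ → ℝ) (f : ℝ → ℂ) (x : ℝ) : ℂ :=
  ((derivWithin φ (Set.Icc a b) x : ℝ) : ℂ)⁻¹ * derivWithin f (Set.Icc a b) x

/-- The integer `m` with `m - 1 ≤ Re θ < m`, for `0 ≤ Re θ`. -/
def derivOrder (θ : ℂ) : ℕ := ⌊θ.re⌋₊ + 1

/-- The coefficients `ā_n(θ, β)` of the analytic function `𝒜̄` attached to the coefficients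
`c = a_n(θ, β)` of `𝒜`. Since `𝒜̄` is used with the parameters `(m - θ, β)`, its transformed series
is `𝒜̄_Γ = ∑ ā_n Γ(β n + m - θ) xⁿ`; it is the inverse of `𝒜_Γ`. -/
def dualCoeff (c : ℕ → ℂ) (θ β : ℂ) (n : ℕ) : ℂ :=
  PowerSeries.coeff n (gammaSeries c θ β)⁻¹ / Complex.Gamma (β * n + (derivOrder θ - θ))

/-- The defining relation `𝒜_Γ · 𝒜̄_Γ = 1`. -/
theorem gammaSeries_mul_gammaSeries_dualCoeff (c : ℕ → ℂ) (θ β : ℂ) (hθ : 0 < θ.re)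
    (hβ : 0 < β.re) (hc : c 0 ≠ 0) :
    gammaSeries c θ β * gammaSeries (dualCoeff c θ β) (derivOrder θ - θ) β = 1 := by
  have h1 : gammaSeries (dualCoeff c θ β) (derivOrder θ - θ) β = (gammaSeries c θ β)⁻¹ := by
    ext n
    have hlt : θ.re < (derivOrder θ : ℝ) := by
      simpa [derivOrder] using Nat.lt_floor_add_one θ.re
    have hG : Complex.Gamma (β * n + (derivOrder θ - θ)) ≠ 0 := by
      apply Complex.Gamma_ne_zero_of_re_pos
      have : 0 ≤ β.re * n := by positivity
      simp
      linarith
    simp only [gammaSeries, PowerSeries.coeff_mk, dualCoeff]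
    exact div_mul_cancel₀ _ hG
  rw [h1]
  apply PowerSeries.mul_inv_cancel
  rw [← PowerSeries.coeff_zero_eq_constantCoeff_apply]
  simp only [gammaSeries, PowerSeries.coeff_mk]
  refine mul_ne_zero hc ?_
  apply Complex.Gamma_ne_zero_of_re_pos
  simpa using hθ

/-- The generalised fractional derivative of order `(θ, β)`, in the Riemann--Liouville sense, of
`u` with respect to `φ` on `[a, b]`, whose kernel has the coefficients `c = a_n(θ, β)`:
`(1/φ' d/dx)^m` applied to the integral of order `(m - θ, β)` with kernel `𝒜̄`. -/
def fracDeriv (a b : ℝ) (φ : ℝ → ℝ) (c : ℕ → ℂ) (θ β : ℂ) (u : ℝ → ℂ) : ℝ → ℂ :=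
  (phiDeriv a b φ)^[derivOrder θ]
    (fracIntegral a b φ (dualCoeff c θ β) (derivOrder θ - θ) β u)

/-- `u ∈ L¹[a, b]` is sufficiently differentiable for `fracDeriv`: the `m` successive derivatives
that define it exist at every point of `(a, b]`. -/
def FracDifferentiable (a b : ℝ) (φ : ℝ → ℝ) (c : ℕ → ℂ) (θ β : ℂ) (u : ℝ → ℂ) : Prop :=
  MeasureTheory.IntegrableOn u (Set.Icc a b) ∧
    ∀ j < derivOrder θ, ∀ x ∈ Set.Ioc a b,
      DifferentiableWithinAt ℝ ((phiDeriv a b φ)^[j]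
        (fracIntegral a b φ (dualCoeff c θ β) (derivOrder θ - θ) β u)) (Set.Icc a b) x

end AnalyticKernel

end

noncomputable section

namespace AnalyticKernel

open MeasureTheory Set Filter Topology intervalIntegral

/-! The substitution `s = φ t - φ a` carries `[a, b]` to `[0, T]`, turns `(1/φ') d/dx` into `d/ds`,
and turns a fractional integral into the convolution with `s ^ (θ - 1) 𝒜(s ^ β)`
(`fracIntegral_eq_volterra`). By the beta integral, the convolution of two such kernels is again
such a kernel: the parameters `θ` add and the transformed series multiply (`volterra_powerKernel`).
The constant `1` is the kernel with `θ = 1` and transformed series `1`, so a primitive raises `θ` by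
one and keeps the transformed series.

Write `m = derivOrder`, `d = m(α) - m(α - γ)`, and `K₁, K₂, K₃` for the kernels of the dual integral
of order `m(α) - α`, of the integral of order `γ`, and of the dual integral of order `m(α - γ) - (α
- γ)`. The coefficient condition says that the transformed series satisfy `P₃ = P₁ P₂`, that is, `K₁
* K₂` is the `d`-fold primitive of `K₃`.

Given this, `d` of the `m(α)` derivatives undo the primitives, and the same `m(α - γ)` derivatives
remain on both sides. For `u` in `L¹` associativity of convolution holds only almost everywhere;
continuity of both sides, implicit in their being defined, makes it hold everywhere
(`volterra_volterra_eqOn`). For smooth `u` both sides are defined because the kernels are smooth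
away from `0` (`contDiffOn_volterra`). Conversely, the single test function `(φ x - φ a) ^ m(α) /
m(α)!` recovers the primitives of both kernels, hence the kernels, and by the identity theorem their
coefficients. -/

/-! ### Convolution on the half-line and its associativity -/

/-- The primitive of `f` that vanishes at `0`. -/
def primitive (f : ℝ → ℂ) (X : ℝ) : ℂ := ∫ s in (0 : ℝ)..X, f s

/-- The convolution of `f` and `g` on the half-line. -/
def volterra (f g : ℝ → ℂ) (X : ℝ) : ℂ := ∫ s in (0 : ℝ)..X, f s * g (X - s)

theorem volterra_comm (f g : ℝ → ℂ) (X : ℝ) : volterra f g X = volterra g f X := by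
  have := intervalIntegral.integral_comp_sub_left (a := 0) (b := X)
    (fun s => f s * g (X - s)) X
  simp only [sub_self, sub_zero, sub_sub_cancel] at this
  rw [volterra, ← this, volterra]
  simp only [mul_comm]

theorem volterra_one_right (f : ℝ → ℂ) (X : ℝ) : volterra f (fun _ => 1) X = primitive f X := by
  simp [volterra, primitive]

theorem volterra_eq_setIntegral (f g : ℝ → ℂ) {X : ℝ} (hX : 0 ≤ X) :
    volterra f g X = ∫ s in Ioo 0 X, f s * g (X - s) := by
  rw [volterra, integral_of_le hX, integral_Ioc_eq_integral_Ioo]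

theorem volterra_congr {f f' g g' : ℝ → ℂ} {X : ℝ} (hX : 0 ≤ X) (hf : EqOn f f' (Ioo 0 X))
    (hg : EqOn g g' (Ioo 0 X)) : volterra f g X = volterra f' g' X := by
  rw [volterra_eq_setIntegral f g hX, volterra_eq_setIntegral f' g' hX]
  refine setIntegral_congr_fun measurableSet_Ioo fun s hs => ?_
  have h2 : X - s ∈ Ioo 0 X := ⟨by linarith [hs.2], by linarith [hs.1]⟩
  simp only [hf hs, hg h2]

theorem primitive_congr {f f' : ℝ → ℂ} {X : ℝ} (hX : 0 ≤ X) (hf : EqOn f f' (Ioo 0 X)) :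
    primitive f X = primitive f' X := by
  rw [← volterra_one_right, ← volterra_one_right]
  exact volterra_congr hX hf fun _ _ => rfl

-- When both factors vanish on `(-∞, 0]`, the whole-line integrand lives on `(0, X)`. This gives
-- access to the theory of convolution on `ℝ`.
open ContinuousLinearMap in
theorem convolution_eq_volterra {X : ℝ} (h0 : 0 ≤ X) {f g : ℝ → ℂ}
    {F G : ℝ → ℂ} (hF : EqOn F f (Ioo 0 X)) (hG : EqOn G g (Ioo 0 X))
    (hF0 : ∀ s ≤ 0, F s = 0) (hG0 : ∀ s ≤ 0, G s = 0) :
    (convolution F G (mul ℝ ℂ) volume) X = volterra f g X := by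
  rw [← volterra_congr h0 hF hG, volterra_eq_setIntegral F G h0, 
    ← MeasureTheory.integral_indicator measurableSet_Ioo, convolution_def]
  congr 1
  ext s
  by_cases hs : s ∈ Ioo 0 X
  · simp [hs]
  · rw [indicator_of_notMem hs, mul_apply']
    by_cases h : s ≤ 0
    · simp [hF0 s h]
    · have : X ≤ s := by
        by_contra h'
        exact hs ⟨not_le.1 h, not_le.1 h'⟩
      simp [hG0 (X - s) (by linarith)]

theorem convolution_indicator_eq_zero {T : ℝ} {f g : ℝ → ℂ} {X : ℝ} (hX : X ≤ 0) :
    (convolution ((Ioc 0 T).indicator f) ((Ioc 0 T).indicator g)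
      (ContinuousLinearMap.mul ℝ ℂ) volume) X = 0 := by
  rw [convolution_def]
  refine integral_eq_zero_of_ae (ae_of_all _ fun s => ?_)
  simp only [Pi.zero_apply]
  rw [ContinuousLinearMap.mul_apply']
  by_cases h : s ≤ 0
  · rw [indicator_of_notMem (fun h' => absurd h'.1 (not_lt.2 h)), zero_mul]
  · rw [indicator_of_notMem (s := Ioc 0 T) (a := X - s), mul_zero]
    intro h'
    linarith [h'.1, not_le.1 h]

theorem indicator_Ioc_eq_zero {T : ℝ} (f : ℝ → ℂ) : ∀ s ≤ 0, (Ioc 0 T).indicator f s = 0 :=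
  fun _ h => indicator_of_notMem (fun h' => absurd h'.1 (not_lt.2 h)) f

theorem indicator_Ioc_eqOn {T X : ℝ} (hX : X ≤ T) (f : ℝ → ℂ) :
    EqOn ((Ioc 0 T).indicator f) f (Ioo 0 X) :=
  fun s h => indicator_of_mem (show s ∈ Ioc 0 T from ⟨h.1, h.2.le.trans hX⟩) f

/-- Convolutions of integrable functions are integrable. -/
theorem integrableOn_volterra {T : ℝ} {f g : ℝ → ℂ} (hf : IntegrableOn f (Ioc 0 T))
    (hg : IntegrableOn g (Ioc 0 T)) : IntegrableOn (volterra f g) (Ioc 0 T) := by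
  have := ((integrable_indicator_iff measurableSet_Ioc).2 hf).integrable_convolution
    (ContinuousLinearMap.mul ℝ ℂ) ((integrable_indicator_iff measurableSet_Ioc).2 hg)
  refine this.integrableOn.congr_fun (fun X hX => ?_) measurableSet_Ioc
  exact convolution_eq_volterra hX.1.le (indicator_Ioc_eqOn hX.2 f)
    (indicator_Ioc_eqOn hX.2 g) (indicator_Ioc_eq_zero f) (indicator_Ioc_eq_zero g)

-- Truncating to `(0, T]` is harmless, since the values at `X ≤ T` see only arguments in `(0, X)`.
-- The hypothesis `h` is the absolute convergence at `X` that Fubini requires.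
open ContinuousLinearMap in
theorem volterra_assoc_of_exists {T : ℝ} {f g k : ℝ → ℂ} (hf : IntegrableOn f (Ioc 0 T))
    (hg : IntegrableOn g (Ioc 0 T)) (hk : IntegrableOn k (Ioc 0 T)) {X : ℝ} (hX : X ∈ Icc 0 T)
    (h : ConvolutionExistsAt (fun x => ‖(Ioc 0 T).indicator f x‖)
      (convolution (fun x => ‖(Ioc 0 T).indicator g x‖) (fun x => ‖(Ioc 0 T).indicator k x‖)
        (mul ℝ ℝ) volume) X (mul ℝ ℝ) volume) :
    volterra (volterra f g) k X = volterra f (volterra g k) X := by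
  have hf' := (integrable_indicator_iff measurableSet_Ioc).2 hf
  have hg' := (integrable_indicator_iff measurableSet_Ioc).2 hg
  have hk' := (integrable_indicator_iff measurableSet_Ioc).2 hk
  have key := convolution_assoc (mul ℝ ℂ) (mul ℝ ℂ) (mul ℝ ℂ) (mul ℝ ℂ)
    (fun x y z => by simp [mul_assoc]) hf'.aestronglyMeasurable
    hg'.aestronglyMeasurable hk'.aestronglyMeasurable (hf'.ae_convolution_exists _ hg')
    (hg'.norm.ae_convolution_exists _ hk'.norm) h
  rwa [convolution_eq_volterra hX.1 (f := volterra f g) (g := k) ?_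
    (indicator_Ioc_eqOn hX.2 k) (fun s hs => convolution_indicator_eq_zero hs)
    (indicator_Ioc_eq_zero k), convolution_eq_volterra hX.1 (f := f) (g := volterra g k)
    (indicator_Ioc_eqOn hX.2 f) ?_
    (indicator_Ioc_eq_zero f) (fun s hs => convolution_indicator_eq_zero hs)] at key
  all_goals
    intro s hs
    have hs' : s ≤ T := hs.2.le.trans hX.2
    exact convolution_eq_volterra hs.1.le (indicator_Ioc_eqOn hs' _)
      (indicator_Ioc_eqOn hs' _) (indicator_Ioc_eq_zero _) (indicator_Ioc_eq_zero _)

theorem ae_volterra_assoc {T : ℝ} {f g k : ℝ → ℂ} (hf : IntegrableOn f (Ioc 0 T))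
    (hg : IntegrableOn g (Ioc 0 T)) (hk : IntegrableOn k (Ioc 0 T)) :
    volterra (volterra f g) k =ᵐ[volume.restrict (Ioc 0 T)] volterra f (volterra g k) := by
  have hf' := ((integrable_indicator_iff measurableSet_Ioc).2 hf).norm
  have hg' := ((integrable_indicator_iff measurableSet_Ioc).2 hg).norm
  have hk' := ((integrable_indicator_iff measurableSet_Ioc).2 hk).norm
  have h := hf'.ae_convolution_exists (ContinuousLinearMap.mul ℝ ℝ)
    (hg'.integrable_convolution (ContinuousLinearMap.mul ℝ ℝ) hk')
  filter_upwards [ae_restrict_of_ae h, ae_restrict_mem measurableSet_Ioc] with X hX hX'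
  exact volterra_assoc_of_exists hf hg hk ⟨hX'.1.le, hX'.2⟩ hX

/-- Associativity holds at every point if the third factor is bounded. -/
theorem volterra_assoc_of_bounded {T : ℝ} {f g k : ℝ → ℂ} (hf : IntegrableOn f (Ioc 0 T))
    (hg : IntegrableOn g (Ioc 0 T)) (hk : IntegrableOn k (Ioc 0 T)) {M : ℝ}
    (hM : ∀ s ∈ Ioc 0 T, ‖k s‖ ≤ M) {X : ℝ} (hX : X ∈ Icc 0 T) :
    volterra (volterra f g) k X = volterra f (volterra g k) X := by
  have hf' := ((integrable_indicator_iff measurableSet_Ioc).2 hf).norm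
  have hg' := ((integrable_indicator_iff measurableSet_Ioc).2 hg).norm
  have hk' := ((integrable_indicator_iff measurableSet_Ioc).2 hk).norm
  have hgk := hg'.integrable_convolution (ContinuousLinearMap.mul ℝ ℝ) hk'
  refine volterra_assoc_of_exists hf hg hk hX ?_
  have hM' : ∀ s, ‖(Ioc 0 T).indicator k s‖ ≤ max M 0 := by
    intro s
    by_cases hs : s ∈ Ioc 0 T
    · rw [indicator_of_mem hs]; exact (hM s hs).trans (le_max_left _ _)
    · rw [indicator_of_notMem hs]; simp
  have hb : ∀ x, ‖convolution (fun x => ‖(Ioc 0 T).indicator g x‖)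
      (fun x => ‖(Ioc 0 T).indicator k x‖) (ContinuousLinearMap.mul ℝ ℝ) volume x‖
        ≤ (∫ t, ‖(Ioc 0 T).indicator g t‖ * max M 0) := by
    intro x
    rw [convolution_def]
    refine norm_integral_le_of_norm_le (hg'.mul_const _) (ae_of_all _ fun t => ?_)
    rw [ContinuousLinearMap.mul_apply', norm_mul, norm_norm, norm_norm]
    exact mul_le_mul_of_nonneg_left (hM' _) (norm_nonneg _)
  refine Integrable.mul_bdd hf' ?_ (ae_of_all _ fun t => hb (X - t))
  exact hgk.aestronglyMeasurable.comp_quasiMeasurePreserving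
    (quasiMeasurePreserving_sub_left_of_right_invariant volume X)

/-! ### Primitives, continuity and smoothness of convolutions -/

theorem integrableOn_one (T : ℝ) : IntegrableOn (fun _ : ℝ => (1 : ℂ)) (Ioc 0 T) := by
  simp

/-- A primitive is a convolution with the bounded function `1`, so this is associativity at every
point. -/
theorem primitive_volterra {T : ℝ} {f g : ℝ → ℂ} (hf : IntegrableOn f (Ioc 0 T))
    (hg : IntegrableOn g (Ioc 0 T)) {X : ℝ} (hX : X ∈ Icc 0 T) :
    primitive (volterra f g) X = volterra f (primitive g) X := by
  rw [← volterra_one_right, volterra_assoc_of_bounded hf hg (integrableOn_one T) (M := 1)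
    (by simp) hX]
  exact volterra_congr hX.1 (fun _ _ => rfl) fun s _ => volterra_one_right g s

theorem continuousOn_primitive_of_integrableOn {T : ℝ} (hT : 0 ≤ T) {f : ℝ → ℂ}
    (hf : IntegrableOn f (Ioc 0 T)) : ContinuousOn (primitive f) (Icc 0 T) := by
  have := continuousOn_primitive_interval' (a := 0)
    ((intervalIntegrable_iff_integrableOn_Ioc_of_le hT).2 hf)
    left_mem_uIcc
  rwa [uIcc_of_le hT] at this

theorem integrableOn_of_continuousOn {T : ℝ} {f : ℝ → ℂ} (hf : ContinuousOn f (Icc 0 T)) :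
    IntegrableOn f (Ioc 0 T) :=
  (hf.integrableOn_compact isCompact_Icc).mono_set Ioc_subset_Icc_self

theorem integrableOn_iterate_primitive {T : ℝ} (hT : 0 ≤ T) {f : ℝ → ℂ}
    (hf : IntegrableOn f (Ioc 0 T)) (d : ℕ) : IntegrableOn (primitive^[d] f) (Ioc 0 T) := by
  induction d with
  | zero => exact hf
  | succ d ih =>
    rw [Function.iterate_succ_apply']
    exact integrableOn_of_continuousOn (continuousOn_primitive_of_integrableOn hT ih)

theorem volterra_iterate_primitive_right {T : ℝ} {f g : ℝ → ℂ}
    (hf : IntegrableOn f (Ioc 0 T)) (hg : IntegrableOn g (Ioc 0 T)) (d : ℕ) {X : ℝ}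
    (hX : X ∈ Icc 0 T) :
    volterra f (primitive^[d] g) X = primitive^[d] (volterra f g) X := by
  have hT : 0 ≤ T := hX.1.trans hX.2
  induction d generalizing X with
  | zero => rfl
  | succ d ih =>
    rw [Function.iterate_succ_apply', Function.iterate_succ_apply',
      ← primitive_volterra hf (integrableOn_iterate_primitive hT hg d) hX]
    exact primitive_congr hX.1 fun s hs => ih ⟨hs.1.le, hs.2.le.trans hX.2⟩

theorem nhdsWithin_Icc_eq_nhdsWithin_Ioc {a b x : ℝ} (hx : x ∈ Ioc a b) :
    𝓝[Icc a b] x = 𝓝[Ioc a b] x := by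
  rw [← Icc_sdiff_left, sdiff_eq, nhdsWithin_inter_of_mem']
  exact mem_nhdsWithin_of_mem_nhds (isOpen_ne.mem_nhds hx.1.ne')

theorem hasDerivWithinAt_primitive {T : ℝ} {f : ℝ → ℂ} (hf : IntegrableOn f (Ioc 0 T))
    (hc : ContinuousOn f (Ioc 0 T)) {X : ℝ} (hX : X ∈ Ioc 0 T) :
    HasDerivWithinAt (primitive f) (f X) (Icc 0 T) X := by
  have hi : IntervalIntegrable f volume 0 X :=
    (intervalIntegrable_iff_integrableOn_Ioc_of_le hX.1.le).2
      (hf.mono_set (Ioc_subset_Ioc_right hX.2))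
  have hn : 𝓝[Icc 0 T] X = 𝓝[Ioc 0 T] X := nhdsWithin_Icc_eq_nhdsWithin_Ioc hX
  -- The instance admitting `𝓝[Icc 0 T] X` in the fundamental theorem of calculus asks for this
  -- fact.
  have : Fact (X ∈ Icc 0 T) := ⟨⟨hX.1.le, hX.2⟩⟩
  refine integral_hasDerivWithinAt_right hi ?_ (t := Icc 0 T) ?_
  · exact ⟨Ioc 0 T, by rw [hn]; exact self_mem_nhdsWithin,
      hc.aestronglyMeasurable measurableSet_Ioc⟩
  · have := hc X hX
    rwa [ContinuousWithinAt, ← hn] at this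

theorem intervalIntegrable_mul_comp_sub {T : ℝ} {κ w : ℝ → ℂ} (hκ : IntegrableOn κ (Ioc 0 T))
    (hw : ContinuousOn w (Icc 0 T)) {X : ℝ} (hX : X ∈ Icc 0 T) :
    IntervalIntegrable (fun s => κ s * w (X - s)) volume 0 X := by
  have h : IntervalIntegrable κ volume 0 X :=
    (intervalIntegrable_iff_integrableOn_Ioc_of_le hX.1).2
      (hκ.mono_set (Ioc_subset_Ioc_right hX.2))
  refine h.mul_continuousOn (hw.comp (by fun_prop) fun s hs => ?_)
  rw [uIcc_of_le hX.1] at hs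
  exact ⟨by linarith [hs.2], by linarith [hs.1, hX.2]⟩

theorem volterra_const_add {T : ℝ} {κ w : ℝ → ℂ} (hκ : IntegrableOn κ (Ioc 0 T))
    (hw : ContinuousOn w (Icc 0 T)) (c : ℂ) {X : ℝ} (hX : X ∈ Icc 0 T) :
    volterra κ (fun s => c + w s) X = c * primitive κ X + volterra κ w X := by
  have h1 := intervalIntegrable_mul_comp_sub hκ hw hX
  have h2 := intervalIntegrable_mul_comp_sub hκ (continuousOn_const (c := c)) hX
  simp only [volterra, primitive, mul_add]
  rw [intervalIntegral.integral_add h2 h1, intervalIntegral.integral_mul_const, mul_comm c]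

/-- After subtraction of `w 0`, the second factor extends continuously by zero to the left of `0`.
The moving end point `X` can then be replaced by `T`, and dominated convergence applies. -/
theorem continuousOn_volterra {T : ℝ} (hT : 0 ≤ T) {κ w : ℝ → ℂ}
    (hκ : IntegrableOn κ (Ioc 0 T)) (hw : ContinuousOn w (Icc 0 T)) :
    ContinuousOn (volterra κ w) (Icc 0 T) := by
  set W : ℝ → ℂ := fun s => w (projIcc 0 T hT s) - w 0 with hWdef
  have hWc : Continuous W :=
    (hw.comp_continuous (continuous_subtype_val.comp continuous_projIcc)
      fun s => (projIcc 0 T hT s).2).sub continuous_const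
  have hW0 : ∀ s ≤ 0, W s = 0 := fun s hs => by
    simp [hWdef, projIcc_of_le_left hT hs]
  have hWw : ∀ s ∈ Icc 0 T, w 0 + W s = w s := fun s hs => by
    simp [hWdef, projIcc_of_mem hT hs]
  obtain ⟨M, hM⟩ : ∃ M, ∀ s, ‖W s‖ ≤ M := by
    obtain ⟨M, hM⟩ := isCompact_Icc.exists_bound_of_continuousOn hw
    refine ⟨M + ‖w 0‖, fun s => (norm_sub_le _ _).trans (add_le_add ?_ le_rfl)⟩
    exact hM _ (projIcc 0 T hT s).2
  have h1 : Continuous fun X => ∫ s in (0 : ℝ)..T, κ s * W (X - s) := by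
    have hκ' := (intervalIntegrable_iff_integrableOn_Ioc_of_le hT).2 hκ
    refine intervalIntegral.continuous_of_dominated_interval (bound := fun s => ‖κ s‖ * M)
      (fun X => ?_) (fun X => ae_of_all _ fun s _ => ?_) (hκ'.norm.mul_const M)
      (ae_of_all _ fun s _ => by fun_prop)
    · exact hκ'.aestronglyMeasurable_restrict_uIoc.mul
        (Continuous.aestronglyMeasurable (by fun_prop))
    · rw [norm_mul]
      exact mul_le_mul_of_nonneg_left (hM _) (norm_nonneg _)
  have h2 : EqOn (volterra κ w)
      (fun X => w 0 * primitive κ X + ∫ s in (0 : ℝ)..T, κ s * W (X - s)) (Icc 0 T) := by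
    intro X hX
    have e1 : volterra κ w X = volterra κ (fun s => w 0 + W s) X :=
      volterra_congr hX.1 (fun _ _ => rfl) fun s hs =>
        (hWw s ⟨hs.1.le, hs.2.le.trans hX.2⟩).symm
    rw [e1, volterra_const_add hκ hWc.continuousOn _ hX]
    congr 1
    rw [volterra, integral_of_le hX.1, integral_of_le hT]
    refine (setIntegral_eq_of_subset_of_forall_sdiff_eq_zero measurableSet_Ioc
      (Ioc_subset_Ioc_right hX.2) fun s hs => ?_).symm
    have : X < s := by
      by_contra h
      exact hs.2 ⟨hs.1.1, not_lt.1 h⟩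
    rw [hW0 _ (by linarith), mul_zero]
  refine ContinuousOn.congr ?_ h2
  exact ((continuousOn_primitive_of_integrableOn hT hκ).const_mul _).add h1.continuousOn

/-- `v` is continuous on `[0, T]` and, up to constants, an `m`-fold primitive of a continuous
function. -/
def IsIteratedPrimitive (T : ℝ) : ℕ → (ℝ → ℂ) → Prop
  | 0, v => ContinuousOn v (Icc 0 T)
  | m + 1, v => ∃ w, IsIteratedPrimitive T m w ∧ EqOn v (fun X => v 0 + primitive w X) (Icc 0 T)

theorem IsIteratedPrimitive.continuousOn {T : ℝ} (hT : 0 ≤ T) {m : ℕ} {v : ℝ → ℂ}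
    (hv : IsIteratedPrimitive T m v) : ContinuousOn v (Icc 0 T) := by
  induction m generalizing v with
  | zero => exact hv
  | succ m ih =>
    obtain ⟨w, hw, h⟩ := hv
    exact ((continuousOn_primitive_of_integrableOn hT
      (integrableOn_of_continuousOn (ih hw))).const_add _).congr h

/-- The derivative of `κ * v` is `v 0 • κ + κ * v'`, which allows induction on `m`. The point `0` is
excluded because `κ` may be singular there. -/
theorem contDiffOn_volterra {T : ℝ} (hT : 0 ≤ T) {m : ℕ} {κ v : ℝ → ℂ}
    (hκ : IntegrableOn κ (Ioc 0 T)) (hκ' : ContDiffOn ℝ m κ (Ioc 0 T))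
    (hv : IsIteratedPrimitive T m v) : ContDiffOn ℝ m (volterra κ v) (Ioc 0 T) := by
  induction m generalizing v with
  | zero =>
    rw [Nat.cast_zero, contDiffOn_zero]
    exact (continuousOn_volterra hT hκ hv).mono Ioc_subset_Icc_self
  | succ m ih =>
    obtain ⟨w, hw, h⟩ := hv
    have hwc := hw.continuousOn hT
    have hwi := integrableOn_of_continuousOn hwc
    have hm : ContDiffOn ℝ m κ (Ioc 0 T) := hκ'.of_le (by simp)
    have hd : ∀ X ∈ Ioc 0 T,
        HasDerivWithinAt (volterra κ v) (v 0 * κ X + volterra κ w X) (Ioc 0 T) X := by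
      intro X hX
      have e : EqOn (volterra κ v)
          (fun X => v 0 * primitive κ X + primitive (volterra κ w) X) (Icc 0 T) := by
        intro Y hY
        have : volterra κ v Y = volterra κ (fun s => v 0 + primitive w s) Y :=
          volterra_congr hY.1 (fun _ _ => rfl) fun s hs => h ⟨hs.1.le, hs.2.le.trans hY.2⟩
        rw [this, volterra_const_add hκ (continuousOn_primitive_of_integrableOn hT hwi) _ hY,
          ← primitive_volterra hκ hwi hY]
      have h1 := hasDerivWithinAt_primitive hκ hm.continuousOn hX
      have h2 := hasDerivWithinAt_primitive (integrableOn_volterra hκ hwi)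
        ((continuousOn_volterra hT hκ hwc).mono Ioc_subset_Icc_self) hX
      exact (((h1.const_mul (v 0)).add h2).congr e (e ⟨hX.1.le, hX.2⟩)).mono Ioc_subset_Icc_self
    have hu : UniqueDiffOn ℝ (Ioc 0 T) := uniqueDiffOn_Ioc 0 T
    rw [Nat.cast_succ, contDiffOn_succ_iff_derivWithin hu]
    refine ⟨fun X hX => (hd X hX).differentiableWithinAt, by simp, ?_⟩
    exact ((contDiffOn_const.mul hm).add (ih hm hw)).congr
      fun X hX => (hd X hX).derivWithin (hu X hX)

/-! ### Power kernels -/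

/-- The kernel `s ^ (θ - 1) 𝒜(s ^ β)` of the generalised fractional integral. -/
def powerKernel (c : ℕ → ℂ) (θ β : ℂ) (s : ℝ) : ℂ :=
  (s : ℂ) ^ (θ - 1) * kernelFun c ((s : ℂ) ^ β)

theorem norm_ofReal_cpow_lt {β : ℂ} (hβ : 0 < β.re) {T R s : ℝ} (hR : T ^ β.re < R)
    (hs : s ∈ Ioc 0 T) : ‖(s : ℂ) ^ β‖ < R := by
  rw [Complex.norm_cpow_eq_rpow_re_of_pos hs.1]
  exact (Real.rpow_le_rpow hs.1.le hs.2 hβ.le).trans_lt hR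

theorem ConvergesOnDisc.summable_norm {c : ℕ → ℂ} {R : ℝ} (hc : ConvergesOnDisc c R) {z : ℂ}
    (hz : ‖z‖ < R) : Summable fun n => ‖c n * z ^ n‖ := (hc z hz).norm

theorem ConvergesOnDisc.analyticOnNhd {c : ℕ → ℂ} {R : ℝ} (hc : ConvergesOnDisc c R) :
    AnalyticOnNhd ℂ (kernelFun c) (Metric.ball 0 R) := by
  intro z hz
  rw [mem_ball_zero_iff] at hz
  obtain ⟨r, hzr, hrR⟩ := exists_between hz
  have hr : 0 ≤ r := (norm_nonneg z).trans hzr.le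
  have hsum := hc.summable_norm (z := (r : ℂ)) (by simpa [abs_of_nonneg hr] using hrR)
  refine (Complex.differentiableOn_tsum_of_summable_norm hsum (fun n => by fun_prop)
    Metric.isOpen_ball (U := Metric.ball 0 r) (F := fun n w => c n * w ^ n)
    fun n w hw => ?_).analyticAt
    (Metric.isOpen_ball.mem_nhds (mem_ball_zero_iff.2 hzr))
  rw [mem_ball_zero_iff] at hw
  simp only [norm_mul, norm_pow, Complex.norm_real, Real.norm_eq_abs, abs_of_nonneg hr]
  gcongr

theorem contDiffOn_powerKernel {c : ℕ → ℂ} {R T : ℝ} {β : ℂ} (hc : ConvergesOnDisc c R)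
    (hβ : 0 < β.re) (hR : T ^ β.re < R) (θ : ℂ) (n : ℕ) :
    ContDiffOn ℝ n (powerKernel c θ β) (Ioc 0 T) := by
  intro s hs
  have hpow : ∀ w : ℂ, ContDiffAt ℝ n (fun t : ℝ => (t : ℂ) ^ w) s := fun w => by
    have h1 : AnalyticAt ℂ (fun z : ℂ => z ^ w) (s : ℂ) :=
      analyticAt_id.cpow analyticAt_const (Complex.ofReal_mem_slitPlane.2 hs.1)
    exact (h1.contDiffAt.restrict_scalars ℝ).comp s Complex.ofRealCLM.contDiff.contDiffAt
  have hk : ContDiffAt ℝ n (kernelFun c) ((s : ℂ) ^ β) :=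
    (hc.analyticOnNhd _ (mem_ball_zero_iff.2
      (norm_ofReal_cpow_lt hβ hR hs))).contDiffAt.restrict_scalars ℝ
  exact ((hpow (θ - 1)).mul (hk.comp s (hpow β))).contDiffWithinAt

/-- The analytic factor is bounded on `(0, T]` by its series of norms at `T ^ β`. -/
theorem integrableOn_powerKernel {c : ℕ → ℂ} {R T : ℝ} {θ β : ℂ} (hc : ConvergesOnDisc c R)
    (hβ : 0 < β.re) (hT : 0 < T) (hR : T ^ β.re < R) (hθ : 0 < θ.re) :
    IntegrableOn (powerKernel c θ β) (Ioc 0 T) := by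
  have h1 : IntegrableOn (fun s : ℝ => (s : ℂ) ^ (θ - 1)) (Ioc 0 T) :=
    (intervalIntegrable_iff_integrableOn_Ioc_of_le hT.le).1
      (intervalIntegrable_cpow' (by simpa using hθ))
  have hm : AEStronglyMeasurable (powerKernel c θ β) (volume.restrict (Ioc 0 T)) :=
    (contDiffOn_powerKernel hc hβ hR θ 0).continuousOn.aestronglyMeasurable measurableSet_Ioc
  have hs := hc.summable_norm (norm_ofReal_cpow_lt hβ hR ⟨hT, le_rfl⟩)
  refine (h1.norm.mul_const (∑' n, ‖c n * ((T : ℂ) ^ β) ^ n‖)).mono' hm ?_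
  filter_upwards [ae_restrict_mem measurableSet_Ioc] with s hs'
  rw [powerKernel, norm_mul]
  refine mul_le_mul_of_nonneg_left ?_ (norm_nonneg _)
  refine tsum_of_norm_bounded hs.hasSum fun n => ?_
  simp only [norm_mul, norm_pow, Complex.norm_cpow_eq_rpow_re_of_pos hs'.1,
    Complex.norm_cpow_eq_rpow_re_of_pos hT]
  have := Real.rpow_le_rpow hs'.1.le hs'.2 hβ.le
  have := Real.rpow_nonneg hs'.1.le β.re
  gcongr

/-- A kernel is determined by its values on `(0, T)`. -/
theorem eq_of_eqOn_powerKernel {c c' : ℕ → ℂ} {R T : ℝ} {θ β : ℂ} (hc : ConvergesOnDisc c R)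
    (hc' : ConvergesOnDisc c' R) (hβ : 0 < β.re) (hT : 0 < T) (hR : 0 < R)
    (h : EqOn (powerKernel c θ β) (powerKernel c' θ β) (Ioo 0 T)) : c = c' := by
  set f : ℂ → ℂ := fun z => kernelFun c z - kernelFun c' z with hf
  have hps : HasFPowerSeriesAt f (FormalMultilinearSeries.ofScalars ℂ fun n => c n - c' n) 0 := by
    rw [hasFPowerSeriesAt_iff]
    filter_upwards [Metric.ball_mem_nhds (0 : ℂ) hR] with z hz
    rw [mem_ball_zero_iff] at hz
    rw [zero_add]
    refine ((hc z hz).hasSum.sub (hc' z hz).hasSum).congr_fun fun n => ?_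
    rw [FormalMultilinearSeries.coeff_ofScalars, smul_eq_mul]
    ring
  -- The points `s ^ β` lie on a curve, a spiral if `β` is not real, that tends to `0` without
  -- reaching it; so the zeros of `f` accumulate at `0`.
  have hfreq : ∃ᶠ z in 𝓝[≠] (0 : ℂ), f z = 0 := by
    have ht : Tendsto (fun s : ℝ => (s : ℂ) ^ β) (𝓝[>] 0) (𝓝[≠] 0) := by
      refine tendsto_nhdsWithin_of_tendsto_nhds_of_eventually_within _ ?_ ?_
      · rw [tendsto_zero_iff_norm_tendsto_zero]
        have h1 : Tendsto (fun s : ℝ => s ^ β.re) (𝓝[>] 0) (𝓝 0) := by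
          have := (Real.continuousAt_rpow_const 0 β.re (Or.inr hβ.le)).tendsto
          rw [Real.zero_rpow hβ.ne'] at this
          exact this.mono_left nhdsWithin_le_nhds
        refine h1.congr' ?_
        filter_upwards [self_mem_nhdsWithin] with s hs
        rw [Complex.norm_cpow_eq_rpow_re_of_pos hs]
      · filter_upwards [self_mem_nhdsWithin] with s hs
        have : (s : ℂ) ≠ 0 := by exact_mod_cast (ne_of_gt hs)
        simp [Complex.cpow_eq_zero_iff, this]
    refine ht.frequently (Eventually.frequently ?_)
    filter_upwards [Ioo_mem_nhdsGT hT] with s hs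
    have h0 : (s : ℂ) ≠ 0 := by exact_mod_cast hs.1.ne'
    have h1 : (s : ℂ) ^ (θ - 1) ≠ 0 := by simp [Complex.cpow_eq_zero_iff, h0]
    have := mul_left_cancel₀ h1 (h hs)
    simp [hf, this]
  have hz : f =ᶠ[𝓝 0] 0 := (hps.analyticAt.frequently_zero_iff_eventually_zero).1 hfreq
  have h0 := (hps.congr hz).eq_zero
  ext n
  have := congrArg (fun p => FormalMultilinearSeries.coeff p n) h0
  simp only [FormalMultilinearSeries.coeff_ofScalars] at this
  exact sub_eq_zero.1 (this.trans rfl)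

/-! ### The beta integral and products of transformed series -/

theorem intervalIntegrable_cpow_mul_sub_cpow {u v : ℂ} (hu : 0 < u.re) (hv : 0 < v.re) {X : ℝ}
    (hX : 0 < X) :
    IntervalIntegrable (fun s : ℝ => (s : ℂ) ^ (u - 1) * ((X - s : ℝ) : ℂ) ^ (v - 1))
      volume 0 X := by
  have h := ((Complex.betaIntegral_convergent hu hv).comp_mul_left (c := X⁻¹)).const_mul
    ((X : ℂ) ^ (u - 1) * (X : ℂ) ^ (v - 1))
  simp only [zero_div, one_div, inv_inv] at h
  refine h.congr fun s hs => ?_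
  rw [uIoc_of_le hX.le] at hs
  have h1 : (X : ℂ) ^ (u - 1) * ((X⁻¹ * s : ℝ) : ℂ) ^ (u - 1) = (s : ℂ) ^ (u - 1) := by
    rw [← Complex.mul_cpow_ofReal_nonneg hX.le (by have := hs.1; positivity),
      ← Complex.ofReal_mul, mul_inv_cancel_left₀ hX.ne']
  have h2 : (X : ℂ) ^ (v - 1) * (1 - ((X⁻¹ * s : ℝ) : ℂ)) ^ (v - 1)
      = ((X - s : ℝ) : ℂ) ^ (v - 1) := by
    have : (1 : ℂ) - ((X⁻¹ * s : ℝ) : ℂ) = ((1 - X⁻¹ * s : ℝ) : ℂ) := by push_cast; ring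
    rw [this, ← Complex.mul_cpow_ofReal_nonneg hX.le, ← Complex.ofReal_mul]
    · congr 2
      field_simp
    · rw [sub_nonneg, inv_mul_le_iff₀ hX, mul_one]
      exact hs.2
  rw [← h1, ← h2]
  ring

/-- The coefficients of the power kernel whose transformed series is `P`. -/
def rlCoeff (P : PowerSeries ℂ) (θ β : ℂ) (n : ℕ) : ℂ :=
  PowerSeries.coeff n P / Complex.Gamma (β * n + θ)

theorem re_mul_natCast_add_pos {θ β : ℂ} (hβ : 0 < β.re) (hθ : 0 < θ.re) (n : ℕ) :
    0 < (β * n + θ).re := by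
  have : 0 ≤ β.re * n := by positivity
  simp
  linarith

theorem rlCoeff_gammaSeries (c : ℕ → ℂ) {θ β : ℂ} (hβ : 0 < β.re) (hθ : 0 < θ.re) :
    rlCoeff (gammaSeries c θ β) θ β = c := by
  ext n
  rw [rlCoeff, gammaSeries, PowerSeries.coeff_mk, mul_div_cancel_right₀]
  exact Complex.Gamma_ne_zero_of_re_pos (re_mul_natCast_add_pos hβ hθ n)

theorem rlCoeff_injective {P Q : PowerSeries ℂ} {θ β : ℂ} (hβ : 0 < β.re) (hθ : 0 < θ.re)
    (h : rlCoeff P θ β = rlCoeff Q θ β) : P = Q := by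
  ext n
  have hG := Complex.Gamma_ne_zero_of_re_pos (re_mul_natCast_add_pos hβ hθ n)
  exact (div_left_inj' hG).1 (congrFun h n)

theorem cpow_sub_one_mul_cpow_pow {s : ℝ} (hs : 0 < s) (θ β : ℂ) (n : ℕ) :
    (s : ℂ) ^ (θ - 1) * ((s : ℂ) ^ β) ^ n = (s : ℂ) ^ (β * n + θ - 1) := by
  have h0 : (s : ℂ) ≠ 0 := by exact_mod_cast hs.ne'
  rw [← Complex.cpow_mul_nat, ← Complex.cpow_add _ _ h0]
  congr 1
  ring

/-- The convolution of two power kernels, as the sum of a power series. -/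
theorem hasSum_volterra_powerKernel {P Q : PowerSeries ℂ} {θ θ' β : ℂ} {R X : ℝ}
    (hβ : 0 < β.re) (hθ : 0 < θ.re) (hθ' : 0 < θ'.re)
    (hP : ConvergesOnDisc (rlCoeff P θ β) R) (hQ : ConvergesOnDisc (rlCoeff Q θ' β) R)
    (hX : 0 < X) (hR : X ^ β.re < R) :
    HasSum (fun k => (X : ℂ) ^ (θ + θ' - 1) *
        (rlCoeff (P * Q) (θ + θ') β k * ((X : ℂ) ^ β) ^ k))
      (volterra (powerKernel (rlCoeff P θ β) θ β) (powerKernel (rlCoeff Q θ' β) θ' β) X) := by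
  set c := rlCoeff P θ β with hc
  set c' := rlCoeff Q θ' β with hc'
  have hP' := hP.summable_norm (norm_ofReal_cpow_lt hβ hR ⟨hX, le_rfl⟩)
  have hQ' := hQ.summable_norm (norm_ofReal_cpow_lt hβ hR ⟨hX, le_rfl⟩)
  set G : ℝ → ℂ := fun s => (s : ℂ) ^ (θ - 1) * ((X - s : ℝ) : ℂ) ^ (θ' - 1) with hG
  have hGi : IntegrableOn G (Ioo 0 X) :=
    ((intervalIntegrable_iff_integrableOn_Ioc_of_le hX.le).1
      (intervalIntegrable_cpow_mul_sub_cpow hθ hθ' hX)).mono_set Ioo_subset_Ioc_self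
  set F : ℕ × ℕ → ℝ → ℂ := fun p s => c p.1 * c' p.2 *
    ((s : ℂ) ^ (β * p.1 + θ - 1) * ((X - s : ℝ) : ℂ) ^ (β * p.2 + θ' - 1)) with hF
  have hFG : ∀ p, ∀ s ∈ Ioo 0 X, F p s =
      (c p.1 * ((s : ℂ) ^ β) ^ p.1) * (c' p.2 * (((X - s : ℝ) : ℂ) ^ β) ^ p.2) * G s := by
    intro p s hs
    simp only [hF, hG]
    rw [← cpow_sub_one_mul_cpow_pow hs.1, ← cpow_sub_one_mul_cpow_pow (sub_pos.2 hs.2)]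
    ring
  have hFi : ∀ p, Integrable (F p) (volume.restrict (Ioo 0 X)) := fun p =>
    (((intervalIntegrable_iff_integrableOn_Ioc_of_le hX.le).1
      (intervalIntegrable_cpow_mul_sub_cpow (re_mul_natCast_add_pos hβ hθ p.1)
        (re_mul_natCast_add_pos hβ hθ' p.2) hX)).mono_set Ioo_subset_Ioc_self).const_mul _
  -- Both `‖s ^ β‖` and `‖(X - s) ^ β‖` are at most `‖X ^ β‖`, so a product of two convergent series
  -- dominates and termwise integration is allowed.
  have hnorm : ∀ p : ℕ × ℕ, ∫ s in Ioo 0 X, ‖F p s‖ ≤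
      ‖c p.1 * ((X : ℂ) ^ β) ^ p.1‖ * ‖c' p.2 * ((X : ℂ) ^ β) ^ p.2‖ *
        ∫ s in Ioo 0 X, ‖G s‖ := by
    intro p
    rw [← MeasureTheory.integral_const_mul]
    refine setIntegral_mono_on (hFi p).norm (hGi.norm.const_mul _) measurableSet_Ioo
      fun s hs => ?_
    rw [hFG p s hs, norm_mul, norm_mul]
    have hmono : ∀ t ∈ Ioo 0 X, ‖(t : ℂ) ^ β‖ ≤ ‖(X : ℂ) ^ β‖ := fun t ht => by
      rw [Complex.norm_cpow_eq_rpow_re_of_pos ht.1, Complex.norm_cpow_eq_rpow_re_of_pos hX]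
      exact Real.rpow_le_rpow ht.1.le ht.2.le hβ.le
    have h1 := hmono s hs
    have h2 := hmono (X - s) ⟨sub_pos.2 hs.2, sub_lt_self _ hs.1⟩
    simp only [norm_mul, norm_pow]
    gcongr
  have hsum : Summable fun p => ∫ s in Ioo 0 X, ‖F p s‖ :=
    Summable.of_nonneg_of_le (fun p => integral_nonneg fun s => norm_nonneg _) hnorm
      ((hP'.mul_of_nonneg hQ' (fun _ => norm_nonneg _) fun _ => norm_nonneg _).mul_right _)
  have key := hasSum_integral_of_summable_integral_norm hFi hsum
  have hval : ∫ s in Ioo 0 X, ∑' p, F p s =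
      volterra (powerKernel c θ β) (powerKernel c' θ' β) X := by
    rw [volterra_eq_setIntegral _ _ hX.le]
    refine setIntegral_congr_fun measurableSet_Ioo fun s hs => ?_
    have h1 := hP.summable_norm (norm_ofReal_cpow_lt hβ hR ⟨hs.1, hs.2.le⟩)
    have h2 := hQ.summable_norm (norm_ofReal_cpow_lt hβ hR
      (s := X - s) ⟨sub_pos.2 hs.2, (sub_lt_self _ hs.1).le⟩)
    simp only [hFG _ s hs, tsum_mul_right, powerKernel, kernelFun]
    rw [← tsum_mul_tsum_of_summable_norm h1 h2]
    simp only [hG]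
    ring
  rw [hval] at key
  have key2 := (Finset.HasAntidiagonal.sigmaAntidiagonalEquivProd.hasSum_iff.2 key).sigma
    fun k => (Finset.hasSum (Finset.HasAntidiagonal.antidiagonal k) fun p => ∫ s in Ioo 0 X, F p s)
  refine key2.congr_fun fun k => ?_
  rw [mul_comm (rlCoeff _ _ _ _), ← mul_assoc, cpow_sub_one_mul_cpow_pow hX, rlCoeff,
    PowerSeries.coeff_mul, Finset.sum_div, Finset.mul_sum]
  -- The factors `Γ(u) Γ(v)` of the beta integral cancel the denominators in `rlCoeff`; `1 / Γ(u +
  -- v)` depends only on `k`.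
  refine Finset.sum_congr rfl fun p hp => ?_
  have hk : β * k + (θ + θ') = (β * p.1 + θ) + (β * p.2 + θ') := by
    rw [← Finset.HasAntidiagonal.mem_antidiagonal.1 hp]
    push_cast
    ring
  have hu := re_mul_natCast_add_pos hβ hθ p.1
  have hv := re_mul_natCast_add_pos hβ hθ' p.2
  have hb := Complex.betaIntegral_scaled (β * p.1 + θ) (β * p.2 + θ') hX
  rw [integral_of_le hX.le, integral_Ioc_eq_integral_Ioo] at hb
  simp only [hF]
  push_cast
  rw [MeasureTheory.integral_const_mul, hb, Complex.betaIntegral_eq_Gamma_mul_div _ _ hu hv, hk,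
    hc, hc', rlCoeff, rlCoeff]
  have g1 := Complex.Gamma_ne_zero_of_re_pos hu
  have g2 := Complex.Gamma_ne_zero_of_re_pos hv
  field_simp

/-- The convolution of power kernels corresponds to the product of their transformed series. -/
theorem volterra_powerKernel {P Q : PowerSeries ℂ} {θ θ' β : ℂ} {R X : ℝ}
    (hβ : 0 < β.re) (hθ : 0 < θ.re) (hθ' : 0 < θ'.re)
    (hP : ConvergesOnDisc (rlCoeff P θ β) R) (hQ : ConvergesOnDisc (rlCoeff Q θ' β) R)
    (hX : 0 < X) (hR : X ^ β.re < R) :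
    volterra (powerKernel (rlCoeff P θ β) θ β) (powerKernel (rlCoeff Q θ' β) θ' β) X =
      powerKernel (rlCoeff (P * Q) (θ + θ') β) (θ + θ') β X := by
  rw [powerKernel, kernelFun, ← tsum_mul_left]
  exact (hasSum_volterra_powerKernel hβ hθ hθ' hP hQ hX hR).tsum_eq.symm

theorem ConvergesOnDisc.rlCoeff_mul {P Q : PowerSeries ℂ} {θ θ' β : ℂ} {R : ℝ}
    (hβ : 0 < β.re) (hθ : 0 < θ.re) (hθ' : 0 < θ'.re)
    (hP : ConvergesOnDisc (rlCoeff P θ β) R) (hQ : ConvergesOnDisc (rlCoeff Q θ' β) R) :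
    ConvergesOnDisc (rlCoeff (P * Q) (θ + θ') β) R := by
  intro z hz
  rcases eq_or_ne z 0 with rfl | hz0
  · exact summable_of_ne_finset_zero (s := {0}) fun n hn => by
      rw [zero_pow (by simpa using hn), mul_zero]
  -- Chosen so that `‖X ^ β‖ = ‖z‖`; absolute convergence depends on the modulus only.
  set X : ℝ := ‖z‖ ^ β.re⁻¹ with hXdef
  have hX : 0 < X := Real.rpow_pos_of_pos (norm_pos_iff.2 hz0) _
  have hXz : X ^ β.re = ‖z‖ := Real.rpow_inv_rpow (norm_nonneg z) hβ.ne'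
  have h := (hasSum_volterra_powerKernel hβ hθ hθ' hP hQ hX (hXz ▸ hz)).summable
  have hX0 : (X : ℂ) ^ (θ + θ' - 1) ≠ 0 := by
    simp [Complex.cpow_eq_zero_iff, hX.ne']
  refine Summable.of_norm (((summable_mul_left_iff hX0).1 h).norm.congr fun n => ?_)
  rw [norm_mul, norm_mul, norm_pow, norm_pow, Complex.norm_cpow_eq_rpow_re_of_pos hX, hXz]

theorem rlCoeff_one_one {β : ℂ} : rlCoeff 1 1 β = Pi.single 0 1 := by
  ext n
  rcases eq_or_ne n 0 with rfl | hn
  · simp [rlCoeff]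
  · simp [rlCoeff, PowerSeries.coeff_one, hn]

theorem convergesOnDisc_rlCoeff_one (β : ℂ) (R : ℝ) : ConvergesOnDisc (rlCoeff 1 1 β) R :=
  fun z _ => summable_of_ne_finset_zero (s := {0}) fun n hn => by
    simp [rlCoeff_one_one, Finset.notMem_singleton.1 hn]

theorem powerKernel_rlCoeff_one (β : ℂ) (s : ℝ) : powerKernel (rlCoeff 1 1 β) 1 β s = 1 := by
  rw [powerKernel, sub_self, Complex.cpow_zero, one_mul, kernelFun, rlCoeff_one_one,
    tsum_eq_single 0]
  · simp
  · intro n hn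
    simp [hn]

/-- This is the product rule with the constant kernel `1`, whose transformed series is `1`. -/
theorem primitive_powerKernel {P : PowerSeries ℂ} {θ β : ℂ} {R X : ℝ}
    (hβ : 0 < β.re) (hθ : 0 < θ.re) (hP : ConvergesOnDisc (rlCoeff P θ β) R)
    (hX : 0 < X) (hR : X ^ β.re < R) :
    primitive (powerKernel (rlCoeff P θ β) θ β) X =
      powerKernel (rlCoeff P (θ + 1) β) (θ + 1) β X := by
  have h := volterra_powerKernel hβ hθ (by simp : 0 < (1 : ℂ).re) hP
    (convergesOnDisc_rlCoeff_one β R) hX hR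
  rw [mul_one] at h
  rw [← h, ← volterra_one_right]
  exact volterra_congr hX.le (fun _ _ => rfl) fun s _ => (powerKernel_rlCoeff_one β s).symm

theorem ConvergesOnDisc.rlCoeff_add_natCast {P : PowerSeries ℂ} {θ β : ℂ} {R : ℝ}
    (hβ : 0 < β.re) (hθ : 0 < θ.re) (hP : ConvergesOnDisc (rlCoeff P θ β) R) (d : ℕ) :
    ConvergesOnDisc (rlCoeff P (θ + d) β) R := by
  induction d with
  | zero => simpa using hP
  | succ d ih =>
    have h := ConvergesOnDisc.rlCoeff_mul hβ
      (by simpa using add_pos_of_pos_of_nonneg hθ d.cast_nonneg : 0 < (θ + d).re)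
      (by simp : 0 < (1 : ℂ).re) ih (convergesOnDisc_rlCoeff_one β R)
    rwa [mul_one, add_assoc, ← Nat.cast_succ] at h

theorem iterate_primitive_powerKernel {P : PowerSeries ℂ} {θ β : ℂ} {R T : ℝ}
    (hβ : 0 < β.re) (hθ : 0 < θ.re) (hP : ConvergesOnDisc (rlCoeff P θ β) R)
    (hR : T ^ β.re < R) (d : ℕ) :
    EqOn (primitive^[d] (powerKernel (rlCoeff P θ β) θ β))
      (powerKernel (rlCoeff P (θ + d) β) (θ + d) β) (Ioc 0 T) := by
  induction d with
  | zero => simp [EqOn]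
  | succ d ih =>
    intro X hX
    rw [Function.iterate_succ_apply', Nat.cast_succ, ← add_assoc,
      ← primitive_powerKernel hβ _ (hP.rlCoeff_add_natCast hβ hθ d) hX.1
        ((Real.rpow_le_rpow hX.1.le hX.2 hβ.le).trans_lt hR)]
    · exact primitive_congr hX.1.le fun s hs => ih ⟨hs.1, hs.2.le.trans hX.2⟩
    · simpa using add_pos_of_pos_of_nonneg hθ d.cast_nonneg

/-! ### The change of variable `X = φ x - φ a` -/

/-- The inverse of `x ↦ φ x - φ a` on `[a, b]`. -/
def phiInv (a b : ℝ) (φ : ℝ → ℝ) (X : ℝ) : ℝ := Function.invFunOn φ (Icc a b) (X + φ a)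

section

variable {a b : ℝ} {φ : ℝ → ℝ}

theorem strictMonoOn_of_derivWithin_pos (hφ : DifferentiableOn ℝ φ (Icc a b))
    (hφ' : ∀ x ∈ Icc a b, 0 < derivWithin φ (Icc a b) x) : StrictMonoOn φ (Icc a b) := by
  refine strictMonoOn_of_deriv_pos (convex_Icc a b) hφ.continuousOn fun x hx => ?_
  have hx' := interior_subset hx
  rw [← derivWithin_of_mem_nhds (mem_interior_iff_mem_nhds.1 hx)]
  exact hφ' x hx'

theorem image_sub_Icc (hc : ContinuousOn φ (Icc a b)) (hm : StrictMonoOn φ (Icc a b)) {x : ℝ}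
    (hx : x ∈ Icc a b) : (fun t => φ t - φ a) '' Icc a x = Icc 0 (φ x - φ a) := by
  have hs : Icc a x ⊆ Icc a b := Icc_subset_Icc_right hx.2
  have hc' : ContinuousOn (fun t => φ t - φ a) (Icc a x) := (hc.mono hs).sub continuousOn_const
  apply Subset.antisymm
  · rintro _ ⟨t, ht, rfl⟩
    exact ⟨sub_nonneg.2 (hm.monotoneOn ⟨le_rfl, hx.1.trans hx.2⟩ (hs ht) ht.1),
      sub_le_sub_right (hm.monotoneOn (hs ht) hx ht.2) _⟩
  · have := intermediate_value_Icc hx.1 hc'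
    rwa [sub_self] at this

theorem sub_mem_Ioc (hm : StrictMonoOn φ (Icc a b)) {x : ℝ} (hx : x ∈ Ioc a b) :
    φ x - φ a ∈ Ioc 0 (φ b - φ a) := by
  have hab : a ≤ b := hx.1.le.trans hx.2
  exact ⟨sub_pos.2 (hm ⟨le_rfl, hab⟩ ⟨hx.1.le, hx.2⟩ hx.1),
    sub_le_sub_right (hm.monotoneOn ⟨hx.1.le, hx.2⟩ ⟨hab, le_rfl⟩ hx.2) _⟩

theorem phiInv_sub (hm : StrictMonoOn φ (Icc a b)) {x : ℝ} (hx : x ∈ Icc a b) :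
    phiInv a b φ (φ x - φ a) = x := by
  rw [phiInv, sub_add_cancel]
  exact hm.injOn.leftInvOn_invFunOn hx

theorem phiInv_spec (hab : a ≤ b) (hc : ContinuousOn φ (Icc a b)) {X : ℝ}
    (hm : StrictMonoOn φ (Icc a b)) (hX : X ∈ Icc 0 (φ b - φ a)) :
    phiInv a b φ X ∈ Icc a b ∧ φ (phiInv a b φ X) - φ a = X := by
  rw [← image_sub_Icc hc hm ⟨hab, le_rfl⟩] at hX
  obtain ⟨x, hx, rfl⟩ := hX
  simp only [phiInv_sub hm hx]
  exact ⟨hx, trivial⟩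

/-- The preimage of a closed set under the inverse is the image of a compact set. -/
theorem continuousOn_phiInv (hab : a ≤ b) (hc : ContinuousOn φ (Icc a b))
    (hm : StrictMonoOn φ (Icc a b)) :
    ContinuousOn (phiInv a b φ) (Icc 0 (φ b - φ a)) := by
  rw [continuousOn_iff_isClosed]
  intro t ht
  refine ⟨(fun x => φ x - φ a) '' (Icc a b ∩ t), ?_, ?_⟩
  · exact ((isCompact_Icc.inter_right ht).image_of_continuousOn
      ((hc.mono inter_subset_left).sub continuousOn_const)).isClosed
  · ext X
    constructor
    · rintro ⟨h1, h2⟩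
      have h3 := phiInv_spec hab hc hm h2
      exact ⟨⟨_, ⟨h3.1, h1⟩, h3.2⟩, h2⟩
    · rintro ⟨⟨x, hx, rfl⟩, h2⟩
      refine ⟨?_, h2⟩
      rw [mem_preimage, phiInv_sub hm hx.1]
      exact hx.2

theorem hasDerivWithinAt_sub (hφ : DifferentiableOn ℝ φ (Icc a b)) {x : ℝ} (hx : x ∈ Icc a b) :
    HasDerivWithinAt (fun t => φ t - φ a) (derivWithin φ (Icc a b) x) (Icc a b) x :=
  (hφ x hx).hasDerivWithinAt.sub_const _

/-- The substitution `s = φ t - φ a`. -/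
theorem integral_comp_phi (hφ : DifferentiableOn ℝ φ (Icc a b))
    (hm : StrictMonoOn φ (Icc a b)) (g : ℝ → ℂ) {x : ℝ} (hx : x ∈ Icc a b) :
    ∫ s in (0 : ℝ)..(φ x - φ a), g s =
      ∫ t in a..x, ((derivWithin φ (Icc a b) t : ℝ) : ℂ) * g (φ t - φ a) := by
  have hs : Icc a x ⊆ Icc a b := Icc_subset_Icc_right hx.2
  have h0 : 0 ≤ φ x - φ a := sub_nonneg.2 (hm.monotoneOn ⟨le_rfl, hx.1.trans hx.2⟩ hx hx.1)
  rw [integral_of_le h0, integral_of_le hx.1, ← integral_Icc_eq_integral_Ioc,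
    ← integral_Icc_eq_integral_Ioc, ← image_sub_Icc hφ.continuousOn hm hx,
    integral_image_eq_integral_deriv_smul_of_monotoneOn measurableSet_Icc
      (fun t ht => (hasDerivWithinAt_sub hφ (hs ht)).mono hs)
      fun s hs' t ht h => sub_le_sub_right (hm.monotoneOn (hs hs') (hs ht) h) _]
  simp only [Complex.real_smul]

/-- The function `v` is left free so that the lemma serves `u ∘ phiInv`, iterated integrals and the
explicit test function alike. -/
theorem fracIntegral_eq_volterra (hφ : DifferentiableOn ℝ φ (Icc a b))
    (hm : StrictMonoOn φ (Icc a b)) (c : ℕ → ℂ) (θ β : ℂ) (u v : ℝ → ℂ)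
    (huv : ∀ t ∈ Icc a b, u t = v (φ t - φ a)) {x : ℝ} (hx : x ∈ Icc a b) :
    fracIntegral a b φ c θ β u x = volterra (powerKernel c θ β) v (φ x - φ a) := by
  rw [volterra_comm, volterra, integral_comp_phi hφ hm _ hx, fracIntegral]
  refine integral_congr fun t ht => ?_
  rw [uIcc_of_le hx.1] at ht
  simp only [powerKernel, sub_sub_sub_cancel_right, huv t ⟨ht.1, ht.2.trans hx.2⟩]
  ring

theorem integrableOn_comp_phiInv (hab : a ≤ b) (hφ : ContDiffOn ℝ 1 φ (Icc a b))
    (hm : StrictMonoOn φ (Icc a b)) (huniq : UniqueDiffOn ℝ (Icc a b)) {u : ℝ → ℂ}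
    (hu : IntegrableOn u (Icc a b)) :
    IntegrableOn (fun X => u (phiInv a b φ X)) (Ioc 0 (φ b - φ a)) := by
  have hd : DifferentiableOn ℝ φ (Icc a b) := hφ.differentiableOn one_ne_zero
  refine IntegrableOn.mono_set ?_ Ioc_subset_Icc_self
  rw [← image_sub_Icc hd.continuousOn hm ⟨hab, le_rfl⟩,
    integrableOn_image_iff_integrableOn_deriv_smul_of_monotoneOn measurableSet_Icc
      (fun t ht => hasDerivWithinAt_sub hd ht)
      fun s hs' t ht h => sub_le_sub_right (hm.monotoneOn hs' ht h) _]
  have : IntegrableOn (fun t => derivWithin φ (Icc a b) t • u t) (Icc a b) :=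
    hu.continuousOn_smul (hφ.continuousOn_derivWithin huniq le_rfl) isCompact_Icc
  exact this.congr_fun (fun t ht => by simp only [phiInv_sub hm ht]) measurableSet_Icc

/-! ### The operator `(1/φ') d/dx` in the new variable -/

theorem phiDeriv_congr {f g : ℝ → ℂ} (h : EqOn f g (Ioc a b)) :
    EqOn (phiDeriv a b φ f) (phiDeriv a b φ g) (Ioc a b) := by
  intro x hx
  rw [phiDeriv, phiDeriv, EventuallyEq.derivWithin_eq _ (h hx)]
  rw [nhdsWithin_Icc_eq_nhdsWithin_Ioc hx]
  exact eventuallyEq_nhdsWithin_of_eqOn h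

theorem iterate_phiDeriv_congr {f g : ℝ → ℂ} (h : EqOn f g (Ioc a b)) (d : ℕ) :
    EqOn ((phiDeriv a b φ)^[d] f) ((phiDeriv a b φ)^[d] g) (Ioc a b) := by
  induction d generalizing f g with
  | zero => exact h
  | succ d ih => exact ih (phiDeriv_congr h)

theorem phiDeriv_primitive (hφ : DifferentiableOn ℝ φ (Icc a b))
    (hφ' : ∀ x ∈ Icc a b, 0 < derivWithin φ (Icc a b) x) {H : ℝ → ℂ}
    (hH : IntegrableOn H (Ioc 0 (φ b - φ a))) (hc : ContinuousOn H (Ioc 0 (φ b - φ a))) :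
    EqOn (phiDeriv a b φ fun x => primitive H (φ x - φ a)) (fun x => H (φ x - φ a))
      (Ioc a b) := by
  intro x hx
  have hm := strictMonoOn_of_derivWithin_pos hφ hφ'
  have hx' : x ∈ Icc a b := ⟨hx.1.le, hx.2⟩
  have hab : a < b := hx.1.trans_le hx.2
  have h1 := (hasDerivWithinAt_primitive hH hc (sub_mem_Ioc hm hx)).scomp x
    (hasDerivWithinAt_sub hφ hx') (s := Icc a b) fun t ht => by
      rw [← image_sub_Icc hφ.continuousOn hm ⟨hab.le, le_rfl⟩]
      exact mem_image_of_mem _ ht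
  have h2 := h1.derivWithin (uniqueDiffOn_Icc hab x hx')
  have h3 : ((derivWithin φ (Icc a b) x : ℝ) : ℂ) ≠ 0 := by exact_mod_cast (hφ' x hx').ne'
  rw [phiDeriv]
  rw [Function.comp_def] at h2
  rw [h2, Complex.real_smul, inv_mul_cancel_left₀ h3]

/-- By the chain rule each derivative removes one primitive. Continuity away from `0` suffices for
`H`, so kernels singular at `0` are covered. -/
theorem iterate_phiDeriv_primitive (hab : a < b) (hφ : DifferentiableOn ℝ φ (Icc a b))
    (hφ' : ∀ x ∈ Icc a b, 0 < derivWithin φ (Icc a b) x) {H : ℝ → ℂ}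
    (hH : IntegrableOn H (Ioc 0 (φ b - φ a))) (hc : ContinuousOn H (Ioc 0 (φ b - φ a)))
    (d : ℕ) :
    EqOn ((phiDeriv a b φ)^[d] fun x => primitive^[d] H (φ x - φ a)) (fun x => H (φ x - φ a))
      (Ioc a b) := by
  have hm := strictMonoOn_of_derivWithin_pos hφ hφ'
  have hT : 0 ≤ φ b - φ a := sub_nonneg.2 (hm.monotoneOn ⟨le_rfl, hab.le⟩ ⟨hab.le, le_rfl⟩ hab.le)
  induction d generalizing H with
  | zero => exact fun x _ => rfl
  | succ d ih =>
    have hJ := continuousOn_primitive_of_integrableOn hT hH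
    intro x hx
    rw [Function.iterate_succ_apply']
    have h1 := ih (integrableOn_of_continuousOn hJ) (hJ.mono Ioc_subset_Icc_self)
    exact (phiDeriv_congr h1 hx).trans (phiDeriv_primitive hφ hφ' hH hc hx)

/-- Needed for `s = Ioc a b` and `s = Icc a b`; `hnhds` makes derivatives within `s` and within `[a,
b]` agree. -/
theorem contDiffOn_phiDeriv {s : Set ℝ} (hs : UniqueDiffOn ℝ s) (hsub : s ⊆ Icc a b)
    (hnhds : ∀ x ∈ s, s ∈ 𝓝[Icc a b] x) (huniq : UniqueDiffOn ℝ (Icc a b))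
    (hφ' : ∀ x ∈ Icc a b, 0 < derivWithin φ (Icc a b) x) {n : ℕ}
    (hφ : ContDiffOn ℝ (n + 1) φ (Icc a b)) {f : ℝ → ℂ} (hf : ContDiffOn ℝ (n + 1) f s) :
    ContDiffOn ℝ n (phiDeriv a b φ f) s := by
  have h1 : ContDiffOn ℝ n (derivWithin φ (Icc a b)) s :=
    ((contDiffOn_succ_iff_derivWithin huniq).1 hφ).2.2.mono hsub
  have h2 : ContDiffOn ℝ n (derivWithin f (Icc a b)) s :=
    (((contDiffOn_succ_iff_derivWithin hs).1 hf).2.2).congr fun x hx =>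
      derivWithin_of_mem_nhdsWithin (hnhds x hx) (huniq x (hsub hx))
        (hf.differentiableOn (by simp) x hx)
  refine ContDiffOn.mul (ContDiffOn.inv ?_ fun x hx => ?_) h2
  · exact Complex.ofRealCLM.contDiff.comp_contDiffOn h1
  · exact_mod_cast (hφ' x (hsub hx)).ne'

theorem contDiffOn_iterate_phiDeriv (hab : a < b)
    (hφ' : ∀ x ∈ Icc a b, 0 < derivWithin φ (Icc a b) x) {n j : ℕ}
    (hφ : ContDiffOn ℝ (n + j : ℕ) φ (Icc a b)) {f : ℝ → ℂ}
    (hf : ContDiffOn ℝ (n + j : ℕ) f (Ioc a b)) :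
    ContDiffOn ℝ n ((phiDeriv a b φ)^[j] f) (Ioc a b) := by
  induction j generalizing f with
  | zero => exact hf
  | succ j ih =>
    refine ih (hφ.of_le (by exact_mod_cast (by omega : n + j ≤ n + (j + 1)))) ?_
    refine contDiffOn_phiDeriv (uniqueDiffOn_Ioc a b) Ioc_subset_Icc_self (fun x hx => ?_)
      (uniqueDiffOn_Icc hab) hφ' (by exact_mod_cast hφ) (by exact_mod_cast hf)
    rw [nhdsWithin_Icc_eq_nhdsWithin_Ioc hx]
    exact self_mem_nhdsWithin

theorem differentiableWithinAt_iterate_phiDeriv (hab : a < b)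
    (hφ' : ∀ x ∈ Icc a b, 0 < derivWithin φ (Icc a b) x) {m j : ℕ} (hj : j < m)
    (hφ : ContDiffOn ℝ m φ (Icc a b)) {f : ℝ → ℂ} (hf : ContDiffOn ℝ m f (Ioc a b)) {x : ℝ}
    (hx : x ∈ Ioc a b) :
    DifferentiableWithinAt ℝ ((phiDeriv a b φ)^[j] f) (Icc a b) x := by
  obtain ⟨n, rfl⟩ := Nat.exists_eq_add_of_lt hj
  rw [show j + n + 1 = (n + 1) + j by ring] at hφ hf
  have := (contDiffOn_iterate_phiDeriv hab hφ' hφ hf).differentiableOn (by simp) x hx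
  refine this.mono_of_mem_nhdsWithin ?_
  rw [nhdsWithin_Icc_eq_nhdsWithin_Ioc hx]
  exact self_mem_nhdsWithin

/-- Integrating `u'` and substituting gives this from continuity of the inverse of `φ` alone; the
inverse is never differentiated. -/
theorem isIteratedPrimitive_comp_phiInv (hab : a < b)
    (hφ' : ∀ x ∈ Icc a b, 0 < derivWithin φ (Icc a b) x) (hd : DifferentiableOn ℝ φ (Icc a b))
    {m : ℕ} (hφ : ContDiffOn ℝ m φ (Icc a b)) {u : ℝ → ℂ} (hu : ContDiffOn ℝ m u (Icc a b)) :
    IsIteratedPrimitive (φ b - φ a) m fun X => u (phiInv a b φ X) := by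
  have hm := strictMonoOn_of_derivWithin_pos hd hφ'
  have hspec := fun X hX => phiInv_spec (X := X) hab.le hd.continuousOn hm hX
  induction m generalizing u with
  | zero =>
    exact hu.continuousOn.comp (continuousOn_phiInv hab.le hd.continuousOn hm)
      fun X hX => (hspec X hX).1
  | succ m ih =>
    refine ⟨fun X => phiDeriv a b φ u (phiInv a b φ X), ih (hφ.of_le (by simp)) ?_,
      fun X hX => ?_⟩
    · exact contDiffOn_phiDeriv (uniqueDiffOn_Icc hab) Subset.rfl
        (fun x _ => self_mem_nhdsWithin) (uniqueDiffOn_Icc hab) hφ' hφ hu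
    · obtain ⟨hx, hX'⟩ := hspec X hX
      set x := phiInv a b φ X
      have h0 : phiInv a b φ 0 = a := by
        simpa using phiInv_sub hm (left_mem_Icc.2 hab.le)
      have hsub : Icc a x ⊆ Icc a b := Icc_subset_Icc_right hx.2
      have hud : ∀ t ∈ Icc a b, HasDerivWithinAt u (derivWithin u (Icc a b) t) (Icc a b) t :=
        fun t ht => (hu.differentiableOn (by simp) t ht).hasDerivWithinAt
      have hftc : ∫ t in a..x, derivWithin u (Icc a b) t = u x - u a := by
        refine integral_eq_sub_of_hasDerivAt_of_le hx.1 (hu.continuousOn.mono hsub)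
          (fun t ht => ?_) ?_
        · exact (hud t (hsub (Ioo_subset_Icc_self ht))).hasDerivAt
            (Icc_mem_nhds ht.1 (ht.2.trans_le hx.2))
        · refine ContinuousOn.intervalIntegrable ?_
          rw [uIcc_of_le hx.1]
          exact (hu.continuousOn_derivWithin (uniqueDiffOn_Icc hab)
            (by simp)).mono hsub
      simp only [h0]
      rw [← hX', primitive, integral_comp_phi hd hm _ hx]
      have : ∫ t in a..x, ((derivWithin φ (Icc a b) t : ℝ) : ℂ) *
          phiDeriv a b φ u (phiInv a b φ (φ t - φ a)) =
          ∫ t in a..x, derivWithin u (Icc a b) t := by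
        refine integral_congr fun t ht => ?_
        rw [uIcc_of_le hx.1] at ht
        have ht' := hsub ht
        have : ((derivWithin φ (Icc a b) t : ℝ) : ℂ) ≠ 0 := by
          exact_mod_cast (hφ' t ht').ne'
        simp only [phiInv_sub hm ht', phiDeriv]
        rw [mul_inv_cancel_left₀ this]
      rw [this, hftc, hX', add_sub_cancel]

/-! ### Composed fractional integrals as iterated convolutions -/

theorem fracIntegral_eq_volterra_phiInv (hφ : DifferentiableOn ℝ φ (Icc a b))
    (hm : StrictMonoOn φ (Icc a b)) (c : ℕ → ℂ) (θ β : ℂ) (u : ℝ → ℂ) {x : ℝ}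
    (hx : x ∈ Icc a b) :
    fracIntegral a b φ c θ β u x =
      volterra (powerKernel c θ β) (fun X => u (phiInv a b φ X)) (φ x - φ a) :=
  fracIntegral_eq_volterra hφ hm c θ β u _ (fun t ht => by rw [phiInv_sub hm ht]) hx

theorem fracIntegral_fracIntegral_eq_volterra (hφ : DifferentiableOn ℝ φ (Icc a b))
    (hm : StrictMonoOn φ (Icc a b)) (c c' : ℕ → ℂ) (θ θ' β : ℂ) (u : ℝ → ℂ) {x : ℝ}
    (hx : x ∈ Icc a b) :
    fracIntegral a b φ c θ β (fracIntegral a b φ c' θ' β u) x =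
      volterra (powerKernel c θ β)
        (volterra (powerKernel c' θ' β) fun X => u (phiInv a b φ X)) (φ x - φ a) :=
  fracIntegral_eq_volterra hφ hm c θ β _ _
    (fun _ ht => fracIntegral_eq_volterra_phiInv hφ hm c' θ' β u ht) hx

/-- Since `derivOrder θ ≥ 1`, the case `j = 0` is always available and makes the integral itself
differentiable. -/
theorem FracDifferentiable.continuousOn {c : ℕ → ℂ} {θ β : ℂ} {u : ℝ → ℂ}
    (h : FracDifferentiable a b φ c θ β u) :
    ContinuousOn (fracIntegral a b φ (dualCoeff c θ β) (derivOrder θ - θ) β u) (Ioc a b) :=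
  fun x hx => ((h.2 0 (Nat.succ_pos _) x hx).mono Ioc_subset_Icc_self).continuousWithinAt

theorem continuousOn_of_comp_phi (hab : a ≤ b) (hc : ContinuousOn φ (Icc a b))
    (hm : StrictMonoOn φ (Icc a b)) {f H : ℝ → ℂ} (hf : ContinuousOn f (Ioc a b))
    (h : ∀ x ∈ Ioc a b, f x = H (φ x - φ a)) : ContinuousOn H (Ioc 0 (φ b - φ a)) := by
  have hmaps : MapsTo (phiInv a b φ) (Ioc 0 (φ b - φ a)) (Ioc a b) := fun X hX => by
    obtain ⟨h1, h2⟩ := phiInv_spec hab hc hm (Ioc_subset_Icc_self hX)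
    refine ⟨lt_of_le_of_ne h1.1 fun h3 => hX.1.ne ?_, h1.2⟩
    rw [← h2, ← h3, sub_self]
  refine (hf.comp ((continuousOn_phiInv hab hc hm).mono Ioc_subset_Icc_self) hmaps).congr
    fun X hX => ?_
  rw [Function.comp_apply, h _ (hmaps hX), (phiInv_spec hab hc hm (Ioc_subset_Icc_self hX)).2]

theorem volterra_iterate_primitive_left {T : ℝ} {f g : ℝ → ℂ}
    (hf : IntegrableOn f (Ioc 0 T)) (hg : IntegrableOn g (Ioc 0 T)) (d : ℕ) {X : ℝ}
    (hX : X ∈ Icc 0 T) :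
    volterra (primitive^[d] f) g X = primitive^[d] (volterra f g) X := by
  rw [volterra_comm, volterra_iterate_primitive_right hg hf d hX,
    show volterra g f = volterra f g from funext fun _ => volterra_comm _ _ _]

/-- Associativity gives the identity almost everywhere, and continuity of both sides gives it
everywhere. On the right, `hc2` is needed only for `d = 0`; otherwise the right side is a primitive.
-/
theorem volterra_volterra_eqOn {T : ℝ} (hT : 0 ≤ T) {K₁ K₂ K v : ℝ → ℂ} {d : ℕ}
    (h1 : IntegrableOn K₁ (Ioc 0 T)) (h2 : IntegrableOn K₂ (Ioc 0 T))
    (h : IntegrableOn K (Ioc 0 T)) (hv : IntegrableOn v (Ioc 0 T))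
    (hK : EqOn (volterra K₁ K₂) (primitive^[d] K) (Ioc 0 T))
    (hc1 : ContinuousOn (volterra K₁ (volterra K₂ v)) (Ioc 0 T))
    (hc2 : ContinuousOn (volterra K v) (Ioc 0 T)) :
    EqOn (volterra K₁ (volterra K₂ v)) (primitive^[d] (volterra K v)) (Ioc 0 T) := by
  refine Measure.eqOn_Ioc_of_ae_eq (μ := volume) ?_ hc1 ?_
  · filter_upwards [ae_volterra_assoc h1 h2 hv, ae_restrict_mem measurableSet_Ioc] with X hX hX'
    rw [← hX, ← volterra_iterate_primitive_left h hv d ⟨hX'.1.le, hX'.2⟩]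
    exact volterra_congr hX'.1.le (fun s hs => hK ⟨hs.1, hs.2.le.trans hX'.2⟩) fun _ _ => rfl
  · cases d with
    | zero => exact hc2
    | succ d =>
      rw [Function.iterate_succ_apply']
      exact (continuousOn_primitive_of_integrableOn hT (integrableOn_iterate_primitive hT
        (integrableOn_volterra h hv) d)).mono Ioc_subset_Icc_self

theorem volterra_volterra_of_continuousOn {T : ℝ} {K₁ K₂ K v : ℝ → ℂ}
    (h1 : IntegrableOn K₁ (Ioc 0 T)) (h2 : IntegrableOn K₂ (Ioc 0 T))
    (hv : ContinuousOn v (Icc 0 T)) (hK : EqOn (volterra K₁ K₂) K (Ioc 0 T)) :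
    EqOn (volterra K₁ (volterra K₂ v)) (volterra K v) (Icc 0 T) := by
  intro X hX
  obtain ⟨M, hM⟩ := isCompact_Icc.exists_bound_of_continuousOn hv
  rw [← volterra_assoc_of_bounded h1 h2 (integrableOn_of_continuousOn hv)
    (fun s hs => hM s (Ioc_subset_Icc_self hs)) hX]
  exact volterra_congr hX.1 (fun s hs => hK ⟨hs.1, hs.2.le.trans hX.2⟩) fun _ _ => rfl

theorem fracDifferentiable_of_eqOn (hab : a < b)
    (hφ' : ∀ x ∈ Icc a b, 0 < derivWithin φ (Icc a b) x) {c : ℕ → ℂ} {θ β : ℂ} {u : ℝ → ℂ}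
    (hd : DifferentiableOn ℝ φ (Icc a b))
    (hφ : ContDiffOn ℝ (derivOrder θ) φ (Icc a b)) (hu : IntegrableOn u (Icc a b)) {H : ℝ → ℂ}
    (hH : ContDiffOn ℝ (derivOrder θ) H (Ioc 0 (φ b - φ a)))
    (h : ∀ x ∈ Ioc a b,
      fracIntegral a b φ (dualCoeff c θ β) (derivOrder θ - θ) β u x = H (φ x - φ a)) :
    FracDifferentiable a b φ c θ β u := by
  have hm := strictMonoOn_of_derivWithin_pos hd hφ'
  refine ⟨hu, fun j hj x hx => differentiableWithinAt_iterate_phiDeriv hab hφ' hj hφ ?_ hx⟩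
  exact (hH.comp ((hφ.mono Ioc_subset_Icc_self).sub contDiffOn_const)
    fun x hx => sub_mem_Ioc hm hx).congr h

theorem iterate_primitive_one (n : ℕ) :
    primitive^[n] (fun _ => 1) = fun X : ℝ => (X : ℂ) ^ n / n.factorial := by
  induction n with
  | zero => simp
  | succ n ih =>
    ext X
    have h : ∫ s in (0 : ℝ)..X, (s : ℂ) ^ n = (X : ℂ) ^ (n + 1) / (n + 1) := by
      have h := integral_pow (a := 0) (b := X) n
      rw [zero_pow n.succ_ne_zero, sub_zero] at h
      have h' := congrArg Complex.ofReal h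
      rw [← intervalIntegral.integral_ofReal] at h'
      simpa using h'
    rw [Function.iterate_succ_apply', ih, primitive, intervalIntegral.integral_div, h,
      Nat.factorial_succ]
    push_cast
    field_simp

/-- Continuous functions on `(0, T]` are determined by their primitives. -/
theorem eqOn_of_primitive_eqOn {T : ℝ} {f g : ℝ → ℂ} (hf : IntegrableOn f (Ioc 0 T))
    (hg : IntegrableOn g (Ioc 0 T)) (hf' : ContinuousOn f (Ioc 0 T))
    (hg' : ContinuousOn g (Ioc 0 T)) (h : EqOn (primitive f) (primitive g) (Ioc 0 T)) :
    EqOn f g (Ioc 0 T) := by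
  intro X hX
  have h1 := (hasDerivWithinAt_primitive hf hf' hX).mono Ioc_subset_Icc_self
  have h2 := (hasDerivWithinAt_primitive hg hg' hX).mono Ioc_subset_Icc_self
  exact (uniqueDiffOn_Ioc 0 T X hX).eq_deriv _ h1 (h2.congr h (h hX))

end

/-! ### The equivalence -/

theorem re_derivOrder_sub_pos (θ : ℂ) : 0 < ((derivOrder θ : ℂ) - θ).re := by
  have := Nat.lt_floor_add_one θ.re
  simpa [derivOrder] using this

theorem derivOrder_sub_le {α γ : ℂ} (hγ : 0 ≤ γ.re) : derivOrder (α - γ) ≤ derivOrder α := by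
  refine Nat.succ_le_succ (Nat.floor_mono ?_)
  simpa using hγ

end AnalyticKernel

end

theorem mainTheorem7 (a b : ℝ) (hab : a < b) (α β γ : ℂ)
    (hα : 0 < α.re) (hβ : 0 < β.re) (hγ : 0 < γ.re) (hγα : γ.re < α.re)
    (φ : ℝ → ℝ) (hφ : ContDiffOn ℝ (AnalyticKernel.derivOrder α) φ (Set.Icc a b))
    (hφ' : ∀ x ∈ Set.Icc a b, 0 < derivWithin φ (Set.Icc a b) x)
    (R : ℝ) (hR : (φ b - φ a) ^ β.re < R)
    (A : ℂ → ℂ → ℕ → ℂ)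
    (hA : ∀ θ ∈ ({α, γ, α - γ} : Set ℂ), AnalyticKernel.ConvergesOnDisc (A θ β) R)
    (hA0 : ∀ θ ∈ ({α, α - γ} : Set ℂ), A θ β 0 ≠ 0)
    (hAbar : ∀ θ ∈ ({α, α - γ} : Set ℂ),
      AnalyticKernel.ConvergesOnDisc (AnalyticKernel.dualCoeff (A θ β) θ β) R) :
    List.TFAE [
      -- the composition relation, for all `u` in `L¹[a, b]` for which both sides are defined
      ∀ u : ℝ → ℂ,
        AnalyticKernel.FracDifferentiable a b φ (A α β) α β
          (AnalyticKernel.fracIntegral a b φ (A γ β) γ β u) →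
        AnalyticKernel.FracDifferentiable a b φ (A (α - γ) β) (α - γ) β u →
        ∀ x ∈ Set.Ioc a b,
          AnalyticKernel.fracDeriv a b φ (A α β) α β
              (AnalyticKernel.fracIntegral a b φ (A γ β) γ β u) x =
            AnalyticKernel.fracDeriv a b φ (A (α - γ) β) (α - γ) β u x,
      -- the composition relation, with both sides defined, for all `u` in `Cᵐ[a, b]`
      ∀ u : ℝ → ℂ, ContDiffOn ℝ (AnalyticKernel.derivOrder α) u (Set.Icc a b) →
        AnalyticKernel.FracDifferentiable a b φ (A α β) α β
            (AnalyticKernel.fracIntegral a b φ (A γ β) γ β u) ∧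
          AnalyticKernel.FracDifferentiable a b φ (A (α - γ) β) (α - γ) β u ∧
          ∀ x ∈ Set.Ioc a b,
            AnalyticKernel.fracDeriv a b φ (A α β) α β
                (AnalyticKernel.fracIntegral a b φ (A γ β) γ β u) x =
              AnalyticKernel.fracDeriv a b φ (A (α - γ) β) (α - γ) β u x,
      -- the coefficient condition
      ∀ k : ℕ,
        AnalyticKernel.dualCoeff (A (α - γ) β) (α - γ) β k *
            Complex.Gamma (β * k - α + γ + AnalyticKernel.derivOrder (α - γ)) =
          ∑ np ∈ Finset.HasAntidiagonal.antidiagonal k,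
            AnalyticKernel.dualCoeff (A α β) α β np.1 * A γ β np.2 *
              Complex.Gamma (β * np.1 - α + AnalyticKernel.derivOrder α) *
              Complex.Gamma (β * np.2 + γ)] := by
  open AnalyticKernel Set MeasureTheory in
  have hd : DifferentiableOn ℝ φ (Icc a b) := hφ.differentiableOn (by simp [derivOrder])
  have hm := strictMonoOn_of_derivWithin_pos hd hφ'
  have hφ1 : ContDiffOn ℝ 1 φ (Icc a b) :=
    hφ.of_le (by exact_mod_cast Nat.succ_le_succ (Nat.zero_le _))
  have hT : 0 < φ b - φ a := (sub_mem_Ioc hm ⟨hab, le_rfl⟩).1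
  have hR0 : 0 < R := (Real.rpow_pos_of_pos hT _).trans hR
  obtain ⟨d, hMd⟩ := Nat.exists_eq_add_of_le (derivOrder_sub_le (α := α) hγ.le)
  -- the three kernels and their transformed series
  set T := φ b - φ a with hTdef
  have p1 : 0 < ((derivOrder α : ℂ) - α).re := re_derivOrder_sub_pos α
  have p3 : 0 < ((derivOrder (α - γ) : ℂ) - (α - γ)).re := re_derivOrder_sub_pos (α - γ)
  set θ₁ : ℂ := (derivOrder α : ℂ) - α with hθ₁
  set θ₃ : ℂ := (derivOrder (α - γ) : ℂ) - (α - γ) with hθ₃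
  -- The `d` surplus derivatives on the left make `K₁ * K₂` and the `d`-fold primitive of `K₃` power
  -- kernels with the same parameter.
  have hθ : θ₁ + γ = θ₃ + d := by
    rw [hθ₁, hθ₃, hMd]
    push_cast
    ring
  have p0 : 0 < (θ₁ + γ).re := by simpa using add_pos p1 hγ
  set c₁ := dualCoeff (A α β) α β with hc₁
  set c₃ := dualCoeff (A (α - γ) β) (α - γ) β with hc₃
  set P₁ := gammaSeries c₁ θ₁ β with hP₁
  set P₂ := gammaSeries (A γ β) γ β with hP₂
  set P₃ := gammaSeries c₃ θ₃ β with hP₃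
  have r1 : rlCoeff P₁ θ₁ β = c₁ := rlCoeff_gammaSeries c₁ hβ p1
  have r2 : rlCoeff P₂ γ β = A γ β := rlCoeff_gammaSeries _ hβ hγ
  have r3 : rlCoeff P₃ θ₃ β = c₃ := rlCoeff_gammaSeries c₃ hβ p3
  have v1 : ConvergesOnDisc c₁ R := hAbar α (by simp)
  have v2 : ConvergesOnDisc (A γ β) R := hA γ (by simp)
  have v3 : ConvergesOnDisc c₃ R := hAbar (α - γ) (by simp)
  have v12 : ConvergesOnDisc (rlCoeff (P₁ * P₂) (θ₁ + γ) β) R :=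
    ConvergesOnDisc.rlCoeff_mul hβ p1 hγ (r1 ▸ v1) (r2 ▸ v2)
  have v30 : ConvergesOnDisc (rlCoeff P₃ (θ₁ + γ) β) R := by
    rw [hθ]
    exact ConvergesOnDisc.rlCoeff_add_natCast hβ p3 (r3 ▸ v3) d
  set K₁ := powerKernel c₁ θ₁ β with hK₁
  set K₂ := powerKernel (A γ β) γ β with hK₂
  set K₃ := powerKernel c₃ θ₃ β with hK₃
  -- On `(0, T]`, `K` is `K₁ * K₂` and `L` is the `d`-fold primitive of `K₃`; they differ only
  -- through `P₁ * P₂` and `P₃`.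
  set K := powerKernel (rlCoeff (P₁ * P₂) (θ₁ + γ) β) (θ₁ + γ) β with hK
  set L := powerKernel (rlCoeff P₃ (θ₁ + γ) β) (θ₁ + γ) β with hL
  have i1 : IntegrableOn K₁ (Ioc 0 T) := integrableOn_powerKernel v1 hβ hT hR p1
  have i2 : IntegrableOn K₂ (Ioc 0 T) := integrableOn_powerKernel v2 hβ hT hR hγ
  have i3 : IntegrableOn K₃ (Ioc 0 T) := integrableOn_powerKernel v3 hβ hT hR p3
  have iK : IntegrableOn K (Ioc 0 T) := integrableOn_powerKernel v12 hβ hT hR p0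
  have iL : IntegrableOn L (Ioc 0 T) := integrableOn_powerKernel v30 hβ hT hR p0
  have s3 : ∀ n : ℕ, ContDiffOn ℝ n K₃ (Ioc 0 T) := contDiffOn_powerKernel v3 hβ hR θ₃
  have sK : ∀ n : ℕ, ContDiffOn ℝ n K (Ioc 0 T) := contDiffOn_powerKernel v12 hβ hR _
  have sL : ∀ n : ℕ, ContDiffOn ℝ n L (Ioc 0 T) := contDiffOn_powerKernel v30 hβ hR _
  have e12 : EqOn (volterra K₁ K₂) K (Ioc 0 T) := fun X hX => by
    have := volterra_powerKernel hβ p1 hγ (r1.symm ▸ v1) (r2.symm ▸ v2) hX.1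
      ((Real.rpow_le_rpow hX.1.le hX.2 hβ.le).trans_lt hR)
    rwa [r1, r2] at this
  have e3 : EqOn (primitive^[d] K₃) L (Ioc 0 T) := by
    have := iterate_primitive_powerKernel hβ p3 (r3.symm ▸ v3) hR d
    rwa [r3, ← hθ] at this
  have hcoeff : (∀ k : ℕ, c₃ k * Complex.Gamma (β * k - α + γ + derivOrder (α - γ)) =
      ∑ np ∈ Finset.HasAntidiagonal.antidiagonal k, c₁ np.1 * A γ β np.2 *
        Complex.Gamma (β * np.1 - α + derivOrder α) * Complex.Gamma (β * np.2 + γ)) ↔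
      P₃ = P₁ * P₂ := by
    rw [PowerSeries.ext_iff]
    refine forall_congr' fun k => ?_
    rw [PowerSeries.coeff_mul, hP₁, hP₂, hP₃]
    simp only [gammaSeries, PowerSeries.coeff_mk]
    have e : β * k - α + γ + derivOrder (α - γ) = β * k + θ₃ := by rw [hθ₃]; ring
    rw [e]
    refine Eq.congr rfl (Finset.sum_congr rfl fun p _ => ?_)
    have e : β * p.1 - α + derivOrder α = β * p.1 + θ₁ := by rw [hθ₁]; ring
    rw [e]
    ring
  rw [hcoeff]
  tfae_have 3 → 1 := by
    intro h u hu1 hu2 x hx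
    have iv : IntegrableOn (fun X => u (phiInv a b φ X)) (Ioc 0 T) :=
      integrableOn_comp_phiInv hab.le hφ1 hm (uniqueDiffOn_Icc hab) hu2.1
    set v := fun X => u (phiInv a b φ X) with hv
    have f1 : ∀ x ∈ Ioc a b, fracIntegral a b φ c₁ θ₁ β (fracIntegral a b φ (A γ β) γ β u) x =
        volterra K₁ (volterra K₂ v) (φ x - φ a) := fun x hx =>
      fracIntegral_fracIntegral_eq_volterra hd hm _ _ _ _ _ _ (Ioc_subset_Icc_self hx)
    have f3 : ∀ x ∈ Ioc a b, fracIntegral a b φ c₃ θ₃ β u x = volterra K₃ v (φ x - φ a) :=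
      fun x hx => fracIntegral_eq_volterra_phiInv hd hm _ _ _ _ (Ioc_subset_Icc_self hx)
    have k1 := continuousOn_of_comp_phi hab.le hd.continuousOn hm hu1.continuousOn f1
    have k3 := continuousOn_of_comp_phi hab.le hd.continuousOn hm hu2.continuousOn f3
    have hK3 : EqOn (volterra K₁ K₂) (primitive^[d] K₃) (Ioc 0 T) := fun X hX => by
      rw [e12 hX, e3 hX, hK, hL, h]
    have key := volterra_volterra_eqOn hT.le i1 i2 i3 iv hK3 k1 k3
    -- The inner `d` derivatives cancel the primitives; the outer ones are common to both sides.
    have hit : (phiDeriv a b φ)^[derivOrder α] =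
        (phiDeriv a b φ)^[derivOrder (α - γ)] ∘ (phiDeriv a b φ)^[d] := by
      rw [hMd, Function.iterate_add]
    rw [fracDeriv, fracDeriv, hit, Function.comp_apply]
    refine iterate_phiDeriv_congr (fun y hy => ?_) _ hx
    have h1 := iterate_phiDeriv_congr (φ := φ)
      (fun y hy => (f1 y hy).trans (key (sub_mem_Ioc hm hy))) d hy
    refine h1.trans ((iterate_phiDeriv_primitive hab hd hφ' (integrableOn_volterra i3 iv) k3 d
      hy).trans (f3 y hy).symm)
  tfae_have 1 → 2 := by
    intro h u hu
    have hv := isIteratedPrimitive_comp_phiInv hab hφ' hd hφ hu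
    have hv3 := isIteratedPrimitive_comp_phiInv hab hφ' hd
      (hφ.of_le (by exact_mod_cast derivOrder_sub_le hγ.le))
      (hu.of_le (n := derivOrder α) (m := derivOrder (α - γ))
        (by exact_mod_cast derivOrder_sub_le hγ.le))
    set v := fun X => u (phiInv a b φ X) with hvdef
    have vc := hv.continuousOn hT.le
    have hI : IntegrableOn (fracIntegral a b φ (A γ β) γ β u) (Icc a b) := by
      refine ContinuousOn.integrableOn_compact isCompact_Icc ?_
      refine ((continuousOn_volterra hT.le i2 vc).comp (hd.continuousOn.sub continuousOn_const)
        fun x hx => ?_).congr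
        fun x hx => fracIntegral_eq_volterra_phiInv hd hm _ _ _ _ hx
      rw [hTdef, ← image_sub_Icc hd.continuousOn hm ⟨hab.le, le_rfl⟩]
      exact mem_image_of_mem _ hx
    -- The continuous `v` is bounded, so the double integral equals `K * v` at every point, and
    -- smoothness of `K` on `(0, T]` is enough.
    have d1 : FracDifferentiable a b φ (A α β) α β (fracIntegral a b φ (A γ β) γ β u) := by
      refine fracDifferentiable_of_eqOn hab hφ' hd hφ hI
        (contDiffOn_volterra hT.le iK (sK _) hv) fun x hx => ?_
      rw [fracIntegral_fracIntegral_eq_volterra hd hm _ _ _ _ _ _ (Ioc_subset_Icc_self hx)]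
      exact volterra_volterra_of_continuousOn i1 i2 vc e12
        (Ioc_subset_Icc_self (sub_mem_Ioc hm hx))
    have d2 : FracDifferentiable a b φ (A (α - γ) β) (α - γ) β u :=
      fracDifferentiable_of_eqOn hab hφ' hd
        (hφ.of_le (by exact_mod_cast derivOrder_sub_le hγ.le))
        (hu.continuousOn.integrableOn_compact isCompact_Icc)
        (contDiffOn_volterra hT.le i3 (s3 _) hv3) fun x hx =>
          fracIntegral_eq_volterra_phiInv hd hm _ _ _ _ (Ioc_subset_Icc_self hx)
    exact ⟨d1, d2, h u d1 d2⟩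
  tfae_have 2 → 3 := by
    intro h
    set M := derivOrder α with hM
    -- Convolving `K` with this `v` gives the `M`-fold primitive of `primitive K`, so the `M`
    -- derivatives on the left leave exactly `primitive K`; likewise the right side leaves
    -- `primitive L`.
    set v : ℝ → ℂ := primitive^[M] fun _ => 1 with hv
    have hvX : ∀ X : ℝ, v X = (X : ℂ) ^ M / M.factorial := fun X => by
      rw [hv, iterate_primitive_one]
    have vc : Continuous v := by
      rw [funext hvX]
      fun_prop
    have hu : ContDiffOn ℝ M (fun x => v (φ x - φ a)) (Icc a b) := by
      simp only [hvX]
      exact ((Complex.ofRealCLM.contDiff.comp_contDiffOn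
        (hφ.sub contDiffOn_const)).pow M).div_const _
    have h1 := integrableOn_one T
    have hT0 := hT.le
    obtain ⟨-, -, hrel⟩ := h _ hu
    have prim : EqOn (primitive K) (primitive L) (Ioc 0 T) := by
      intro X hX
      obtain ⟨hx, hX'⟩ := phiInv_spec hab.le hd.continuousOn hm (Ioc_subset_Icc_self hX)
      have hx' : phiInv a b φ X ∈ Ioc a b := by
        refine ⟨lt_of_le_of_ne hx.1 fun h3 => hX.1.ne ?_, hx.2⟩
        rw [← hX', ← h3, sub_self]
      have hrelx := hrel _ hx'
      have q1 : EqOn (fracIntegral a b φ c₁ θ₁ β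
          (fracIntegral a b φ (A γ β) γ β fun x => v (φ x - φ a)))
          (fun x => primitive^[M] (primitive K) (φ x - φ a)) (Ioc a b) := by
        intro y hy
        have hy' := Ioc_subset_Icc_self (sub_mem_Ioc hm hy)
        rw [fracIntegral_eq_volterra hd hm _ _ _ _ _ (fun t ht =>
          fracIntegral_eq_volterra hd hm _ _ _ _ v (fun _ _ => rfl) ht) (Ioc_subset_Icc_self hy)]
        rw [← hK₁, ← hK₂, volterra_volterra_of_continuousOn i1 i2 vc.continuousOn e12 hy', hv,
          volterra_iterate_primitive_right iK h1 M hy',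
          funext (volterra_one_right K)]
      have q3 : EqOn (fracIntegral a b φ c₃ θ₃ β fun x => v (φ x - φ a))
          (fun x => primitive^[derivOrder (α - γ)] (primitive^[d] (primitive K₃)) (φ x - φ a))
          (Ioc a b) := by
        intro y hy
        have hy' := Ioc_subset_Icc_self (sub_mem_Ioc hm hy)
        rw [fracIntegral_eq_volterra hd hm _ _ _ _ v (fun _ _ => rfl) (Ioc_subset_Icc_self hy)]
        rw [← hK₃, hv, volterra_iterate_primitive_right i3 h1 M hy',
          funext (volterra_one_right K₃), ← Function.iterate_add_apply, ← hMd]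
      have cK := continuousOn_primitive_of_integrableOn hT0 iK
      have cL := continuousOn_primitive_of_integrableOn hT0 iL
      have hJ : EqOn (primitive^[d] (primitive K₃)) (primitive L) (Icc 0 T) := fun Y hY => by
        rw [← Function.iterate_succ_apply, Function.iterate_succ_apply']
        exact primitive_congr hY.1 fun s hs => e3 ⟨hs.1, hs.2.le.trans hY.2⟩
      rw [fracDeriv, fracDeriv, iterate_phiDeriv_congr q1 _ hx', iterate_phiDeriv_congr q3 _ hx',
        iterate_phiDeriv_primitive hab hd hφ' (integrableOn_of_continuousOn cK)
          (cK.mono Ioc_subset_Icc_self) _ hx',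
        iterate_phiDeriv_primitive hab hd hφ' (integrableOn_of_continuousOn (cL.congr hJ))
          ((cL.congr hJ).mono Ioc_subset_Icc_self) _ hx'] at hrelx
      simp only [hX'] at hrelx
      exact hrelx.trans (hJ (Ioc_subset_Icc_self hX))
    have hKL := eqOn_of_primitive_eqOn iK iL (sK 0).continuousOn (sL 0).continuousOn prim
    have := eq_of_eqOn_powerKernel v12 v30 hβ hT hR0 (hKL.mono Ioo_subset_Ioc_self)
    exact (rlCoeff_injective hβ p0 this).symm
  tfae_finish
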